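/- All graphs are finite, undirected and simple. A \emph{drawing} of a graph represents each vertex by a distinct point in the plane and each edge by a simple curve between its endpoints, such that the only vertices on an edge are its own endpoints and no three edges have a common point other than a common endpoint. A \emph{crossing} is a point of intersection between two edges other than a common endpoint; a graph is \emph{planar} if it has a drawing without crossings. The \emph{crossing number} of a graph is the minimum number of crossings in a drawing of it in the plane, and the \emph{minor crossing number} $\mathrm{mcr}(G)$ of a graph $G$ is the minimum crossing number of a graph that contains $G$ as a minor (that is, from a subgraph of which a graph isomorphic to $G$ can be obtained by contracting edges). A \emph{decomposition} of a graph $G$ is a graph $D$ each of whose vertices is (labelled by) a set of vertices of $G$, called a \emph{bag}, where distinct vertices of $D$ may be the same set, such that for each vertex $v$ of $G$ the subgraph $D(v)$ of $D$ induced by the bags containing $v$ is connected and nonempty, and for each edge $vw$ of $G$ the subgraphs $D(v)$ and $D(w)$ have a common vertex or are joined by an edge of $D$. Its \emph{width} is the maximum cardinality of a bag, its \emph{order} is the number of bags, and it is \emph{planar} if the graph $D$ is planar. \textbf{Lemma.} Every graph $G$ has a planar decomposition of width at most $2$ and order at most $|V(G)|+2\,\mathrm{mcr}(G)$. -/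

import Mathlib

universe u v

/-- The Euclidean plane. -/
abbrev Plane : Type := EuclideanSpace ℝ (Fin 2)

/-- A drawing of a graph in the plane: vertices are distinct points, every edge is a simple curve
(including its ends) between its two end-vertices that contains no further vertex, and no three
edges have a common point other than a common end-vertex. -/
structure GraphDrawing {V : Type u} (G : SimpleGraph V) where
  /-- the point that represents a vertex -/
  point : V → Plane
  /-- the curve that represents an edge -/
  curve : G.edgeSet → unitInterval → Plane
  point_injective : Function.Injective point
  curve_continuous : ∀ e, Continuous (curve e)
  curve_injective : ∀ e, Function.Injective (curve e)
  curve_ends : ∀ e, s(curve e 0, curve e 1) = Sym2.map point e.1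
  mem_of_point_mem_curve : ∀ e x, point x ∈ Set.range (curve e) → x ∈ e.1
  no_three : ∀ e f g, e ≠ f → e ≠ g → f ≠ g → ∀ p,
    p ∈ Set.range (curve e) → p ∈ Set.range (curve f) → p ∈ Set.range (curve g) →
      ∃ x, x ∈ e.1 ∧ x ∈ f.1 ∧ x ∈ g.1 ∧ point x = p

/-- The crossings of a drawing: the points that lie on two distinct edges and are not a common
end-vertex of the two. (No third edge passes through such a point, so that counting the points is
the same as counting pairs of edges together with a crossing point.) -/
def GraphDrawing.crossings {V : Type u} {G : SimpleGraph V} (Γ : GraphDrawing G) : Set Plane :=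
  {p | ∃ e f, e ≠ f ∧ p ∈ Set.range (Γ.curve e) ∧ p ∈ Set.range (Γ.curve f) ∧
    ¬ ∃ x, x ∈ e.1 ∧ x ∈ f.1 ∧ Γ.point x = p}

/-- A graph is planar if it has a drawing without crossings. -/
def IsPlanarGraph {V : Type u} (G : SimpleGraph V) : Prop :=
  ∃ Γ : GraphDrawing G, Γ.crossings = ∅

/-- The crossing number: the minimum number of crossings in a drawing of the graph. It takes values
in `ℕ∞`, since a single drawing may have infinitely many crossings. -/
noncomputable def crossingNumber {V : Type u} (G : SimpleGraph V) : ℕ∞ :=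
  ⨅ Γ : GraphDrawing G, Γ.crossings.encard

/-- `G` is (up to isomorphism) obtained from `K` by contracting one edge `ab` of `K`: the map `f`
identifies the vertices `a` and `b` and no others; loops and parallel edges disappear. -/
def IsEdgeContraction {U : Type u} {V : Type v} (K : SimpleGraph U) (G : SimpleGraph V) : Prop :=
  ∃ (a b : U) (f : U → V), K.Adj a b ∧ Function.Surjective f ∧
    (∀ x y, f x = f y ↔ x = y ∨ (x = a ∧ y = b) ∨ (x = b ∧ y = a)) ∧
    ∀ s t, G.Adj s t ↔ s ≠ t ∧ ∃ x y, f x = s ∧ f y = t ∧ K.Adj x y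

/-- `IsMinor H G`: the graph `G` is a minor of `H`, that is, `G` can be obtained, up to isomorphism,
from a subgraph of `H` by contracting edges. -/
inductive IsMinor {W : Type v} (H : SimpleGraph W) : {V : Type u} → SimpleGraph V → Prop
  | of_isContained {V : Type u} {G : SimpleGraph V} (h : G.IsContained H) : IsMinor H G
  | contract {U V : Type u} {K : SimpleGraph U} {G : SimpleGraph V}
      (hK : IsMinor H K) (h : IsEdgeContraction K G) : IsMinor H G

/-- The minor crossing number: the minimum crossing number of a finite graph that contains `G` as a
minor. (Every finite graph is isomorphic to one on some `Fin m`.) -/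
noncomputable def minorCrossingNumber {V : Type u} (G : SimpleGraph V) : ℕ∞ :=
  ⨅ (m : ℕ) (H : SimpleGraph (Fin m)) (_ : IsMinor H G), crossingNumber H

/-- Two sets `A`, `B` of vertices of a graph (equivalently, the subgraphs that they induce) touch
if they intersect or some edge joins a vertex of `A` to a vertex of `B`. -/
def Touch {ι : Type v} (D : SimpleGraph ι) (A B : Set ι) : Prop :=
  (A ∩ B).Nonempty ∨ ∃ i ∈ A, ∃ j ∈ B, D.Adj i j

/-- A decomposition of a graph `G`: a graph on an index type `ι` whose vertices `i` carry bags
`bag i` of vertices of `G` (different indices may carry equal bags), such that the subgraph induced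
by the bags containing a given vertex is connected and nonempty, and such that these subgraphs
touch for adjacent vertices. (`SimpleGraph.Connected` includes nonemptiness.) -/
structure GraphDecomposition {V : Type u} (G : SimpleGraph V) (ι : Type v) where
  /-- the graph on the bags -/
  graph : SimpleGraph ι
  /-- the bags -/
  bag : ι → Finset V
  connected : ∀ x : V, (graph.induce {i | x ∈ bag i}).Connected
  touch : ∀ x y : V, G.Adj x y → Touch graph {i | x ∈ bag i} {i | y ∈ bag i}

/-- A decomposition is planar if its graph is planar. -/
def GraphDecomposition.IsPlanar {V : Type u} {G : SimpleGraph V} {ι : Type v}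
    (D : GraphDecomposition G ι) : Prop :=
  IsPlanarGraph D.graph

/-- The width of a decomposition: the maximum cardinality of a bag (`0` if there is no bag). -/
def GraphDecomposition.width {V : Type u} {G : SimpleGraph V} {ι : Type v} [Fintype ι]
    (D : GraphDecomposition G ι) : ℕ :=
  Finset.univ.sup fun i => (D.bag i).card

/-- The order of a decomposition: the number of bags. -/
def GraphDecomposition.order {V : Type u} {G : SimpleGraph V} {ι : Type v} [Fintype ι]
    (_D : GraphDecomposition G ι) : ℕ :=
  Fintype.card ι

/-!
Let `H` be a graph that contains `G` as a minor, drawn with `c` crossings, where `c` is the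
minor crossing number of `G`. The argument yields at most `|V(G)| + c` bags.

*Planarization.* Direct every edge of `H` and put a new vertex on every crossing. Give a vertex `x`
of `H` the bag `{x}` and a crossing the tails of the two edges that cross there. The bags that
contain `x` are then `{x}` and the nodes on the edges that leave `x`, and the last node of an edge
before its head is adjacent to its head. So this is a planar decomposition of `H` of width at
most `2` (`hasNetDecomposition_of_drawing`), in which at most `c` bags have two elements.

*Minors.* Bags pass to a minor: restrict them for a subgraph, and take their images for a
contraction. The decomposing graph stays the same, and the number of two-element bags does not grow
(`HasNetDecomposition.of_isMinor`). It remains to discard bags. An empty bag can be deleted, and a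
bag `{x}` next to another bag that contains `x` can be contracted into it; when neither is possible,
the bags with fewer than two elements are singletons of distinct vertices of `G`, so that there
are at most `|V(G)| + c` bags (`HasNetDecomposition.exists_le`).

*Contraction in the plane.* The topological core is that planarity survives the contraction of an
edge `ab` that is drawn as an arbitrary curve (`PlaneNet.exists_contract`). Take small disjoint
discs `A`, `B` around `a`, `b`, and cut the other edges at `a` and `b` where they leave the discs
for the last time. The curve `ab` avoids what is left of the drawing, hence a simple polygonal arc
joins `A` to `B` in the complement. The union of `A`, `B` and this arc is collapsed to a point by a
continuous self-map of the plane that is injective elsewhere, and this map carries the truncated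
drawing to a drawing of the contracted graph. The map is a composition of elementary collapses
(`Collapsible.union_of_convex`): a compact convex set `K` is shrunk radially to the point `c` at
which the rest of the arc is attached. Rays from `c` are preserved, so the next segment of the arc
stays a segment, and the remainder of the arc, being away from `K`, is fixed.

If the minor crossing number were infinite, the bound would be void, and a grid with the bags
`{x, y}` serves as the decomposition (`exists_hasNetDecomposition`).
-/

namespace PlanarDecomposition

open Set Metric Topology Filter

/-! ### Collapsing convex sets and polygonal arcs -/

section Collapse

variable {E : Type*} [NormedAddCommGroup E] [NormedSpace ℝ E]

/-- A set is collapsible if some continuous self-map of the space identifies all its points and is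
injective otherwise. -/
def Collapsible (C : Set E) : Prop :=
  ∃ Φ : E → E, Continuous Φ ∧ ∀ x y, Φ x = Φ y ↔ x = y ∨ (x ∈ C ∧ y ∈ C)

/-- The map that shrinks `K` to its point `c`, moving every point along its ray from `c`, and that
fixes the points at distance at least `ε` from `K`. -/
noncomputable def radialCollapse (K : Set E) (c : E) (ε : ℝ) (x : E) : E :=
  c + min 1 (infDist x K / ε) • (x - c)

lemma continuous_radialCollapse (K : Set E) (c : E) (ε : ℝ) :
    Continuous (radialCollapse K c ε) := by
  unfold radialCollapse
  have := continuous_infDist_pt K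
  fun_prop

lemma radialCollapse_of_mem {K : Set E} {c : E} {ε : ℝ} {x : E} (hx : x ∈ K) :
    radialCollapse K c ε x = c := by
  simp [radialCollapse, infDist_zero_of_mem hx]

lemma radialCollapse_of_le {K : Set E} {c : E} {ε : ℝ} (hε : 0 < ε) {x : E}
    (hx : ε ≤ infDist x K) : radialCollapse K c ε x = x := by
  have : 1 ≤ infDist x K / ε := by rwa [one_le_div hε]
  simp [radialCollapse, min_eq_left this]

/-- The distance to a convex set is at most linear along a ray that starts in the set. -/
lemma infDist_ray_le {K : Set E} (hK : Convex ℝ K) {c : E} (hc : c ∈ K) {s : ℝ} (h0 : 0 ≤ s)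
    (h1 : s ≤ 1) (v : E) : infDist (c + s • v) K ≤ s * infDist (c + v) K := by
  rcases h0.eq_or_lt with rfl | h0
  · simp [infDist_zero_of_mem hc]
  rw [← div_le_iff₀' h0]
  refine (le_infDist ⟨c, hc⟩).2 fun z hz => ?_
  rw [div_le_iff₀' h0]
  have hz' : c + s • (z - c) ∈ K := hK.add_smul_sub_mem hc hz ⟨h0.le, h1⟩
  refine (infDist_le_dist_of_mem hz').trans ?_
  have e : c + s • v - (c + s • (z - c)) = s • (c + v - z) := by module
  rw [dist_eq_norm, dist_eq_norm, e, norm_smul, Real.norm_of_nonneg h0.le]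

lemma radialCollapse_coeff_pos {X : Type*} [PseudoMetricSpace X] {K : Set X} (hK : IsClosed K)
    {c : X} (hc : c ∈ K) {ε : ℝ} (hε : 0 < ε) {x : X} (hx : x ∉ K) : 0 < min 1 (infDist x K / ε) :=
  lt_min one_pos (div_pos ((hK.notMem_iff_infDist_pos ⟨c, hc⟩).1 hx) hε)

lemma eq_of_radialCollapse_eq_aux {K : Set E} (hK : IsClosed K) (hKc : Convex ℝ K) {c : E}
    (hc : c ∈ K) {ε : ℝ} (hε : 0 < ε) {x y : E} (hx : x ∉ K) (hy : y ∉ K)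
    (h : radialCollapse K c ε x = radialCollapse K c ε y)
    (hle : min 1 (infDist x K / ε) ≤ min 1 (infDist y K / ε)) : x = y := by
  have hx0 := radialCollapse_coeff_pos hK hc hε hx
  have hy0 := radialCollapse_coeff_pos hK hc hε hy
  simp only [radialCollapse, add_right_inj] at h
  generalize ha : min 1 (infDist x K / ε) = a at *
  generalize hb : min 1 (infDist y K / ε) = b at *
  have hs1 : a / b ≤ 1 := (div_le_one hy0).2 hle
  have hyx : y - c = (a / b) • (x - c) := by
    rw [div_eq_inv_mul, mul_smul, h, inv_smul_smul₀ hy0.ne']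
  have hd : infDist y K ≤ infDist x K := by
    have := infDist_ray_le hKc hc (by positivity : 0 ≤ a / b) hs1 (x - c)
    rw [← hyx] at this
    simp only [add_sub_cancel] at this
    exact this.trans (mul_le_of_le_one_left infDist_nonneg hs1)
  have hab : a = b := by
    refine le_antisymm hle ?_
    rw [← ha, ← hb]
    gcongr
  rw [hab, div_self hy0.ne', one_smul] at hyx
  exact (sub_left_injective hyx).symm

lemma radialCollapse_eq_iff {K : Set E} (hK : IsClosed K) (hKc : Convex ℝ K) {c : E}
    (hc : c ∈ K) {ε : ℝ} (hε : 0 < ε) (x y : E) :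
    radialCollapse K c ε x = radialCollapse K c ε y ↔ x = y ∨ (x ∈ K ∧ y ∈ K) := by
  constructor
  · have key : ∀ u w, u ∈ K → radialCollapse K c ε u = radialCollapse K c ε w → w ∈ K := by
      intro u w hu h
      by_contra hw
      have h0 := radialCollapse_coeff_pos hK hc hε hw
      rw [radialCollapse_of_mem hu, radialCollapse, left_eq_add, smul_eq_zero, sub_eq_zero] at h
      rcases h with h | rfl
      · exact h0.ne' h
      · exact hw hc
    intro h
    by_cases hx : x ∈ K
    · exact Or.inr ⟨hx, key _ _ hx h⟩
    by_cases hy : y ∈ K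
    · exact absurd (key _ _ hy h.symm) hx
    left
    rcases le_total (min 1 (infDist x K / ε)) (min 1 (infDist y K / ε)) with hle | hle
    · exact eq_of_radialCollapse_eq_aux hK hKc hc hε hx hy h hle
    · exact (eq_of_radialCollapse_eq_aux hK hKc hc hε hy hx h.symm hle).symm
  · rintro (rfl | ⟨hx, hy⟩)
    · rfl
    · rw [radialCollapse_of_mem hx, radialCollapse_of_mem hy]

lemma infDist_radialCollapse_le {K : Set E} (hKc : Convex ℝ K) {c : E} (hc : c ∈ K) {ε : ℝ}
    (hε : 0 < ε) (x : E) : infDist (radialCollapse K c ε x) K ≤ infDist x K := by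
  have h0 : 0 ≤ min 1 (infDist x K / ε) := le_min zero_le_one (div_nonneg infDist_nonneg hε.le)
  have := infDist_ray_le hKc hc h0 (min_le_left _ _) (x - c)
  simp only [add_sub_cancel] at this
  exact this.trans (mul_le_of_le_one_left infDist_nonneg (min_le_left _ _))

/-- The radial collapse respects a segment that leaves its centre and reaches out of the
neighbourhood of `K` in which points are moved. -/
lemma radialCollapse_mem_segment_iff {K : Set E} (hK : IsClosed K) (hKc : Convex ℝ K) {c q : E}
    (hc : c ∈ K) {ε : ℝ} (hε : 0 < ε) (hq : ε ≤ infDist q K) (x : E) :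
    radialCollapse K c ε x ∈ segment ℝ c q ↔ x ∈ K ∪ segment ℝ c q := by
  have hray : ∀ z, z ∈ segment ℝ c q ↔ ∃ θ ∈ Icc (0 : ℝ) 1, z = c + θ • (q - c) := by
    intro z
    rw [segment_eq_image']
    simp only [mem_image, eq_comm]
  constructor
  · intro h
    by_cases hx : x ∈ K
    · exact Or.inl hx
    right
    have hpos := radialCollapse_coeff_pos hK hc hε hx
    rcases le_or_gt ε (infDist x K) with hd | hd
    · rwa [radialCollapse_of_le hε hd] at h
    obtain ⟨θ, ⟨h0, h1⟩, hθ⟩ := (hray _).1 h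
    simp only [radialCollapse, add_right_inj] at hθ
    generalize min 1 (infDist x K / ε) = a at *
    have hxc : x - c = (θ / a) • (q - c) := by
      rw [div_eq_inv_mul, mul_smul, ← hθ, inv_smul_smul₀ hpos.ne']
    rcases le_or_gt (θ / a) 1 with hle | hgt
    · exact (hray _).2 ⟨θ / a, ⟨by positivity, hle⟩, by rw [← hxc]; abel⟩
    -- Otherwise `q` lies between `c` and `x`, hence in the region where points are moved.
    exfalso
    have hqx : q = c + (θ / a)⁻¹ • (x - c) := by
      rw [hxc, inv_smul_smul₀ (by positivity)]
      abel
    have hle : (θ / a)⁻¹ ≤ 1 := inv_le_one_of_one_le₀ hgt.le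
    have := infDist_ray_le hKc hc (by positivity : 0 ≤ (θ / a)⁻¹) hle (x - c)
    rw [← hqx] at this
    simp only [add_sub_cancel] at this
    have := this.trans (mul_le_of_le_one_left infDist_nonneg hle)
    linarith
  · rintro (h | h)
    · rw [radialCollapse_of_mem h]
      exact left_mem_segment ℝ c q
    · obtain ⟨θ, ⟨h0, h1⟩, rfl⟩ := (hray _).1 h
      refine (hray _).2 ⟨min 1 (infDist (c + θ • (q - c)) K / ε) * θ, ⟨?_, ?_⟩, ?_⟩
      · exact mul_nonneg (le_min zero_le_one (div_nonneg infDist_nonneg hε.le)) h0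
      · exact mul_le_one₀ (min_le_left _ _) h0 h1
      · rw [radialCollapse, add_sub_cancel_left, mul_smul]

/-- A compact convex set attached to a collapsible set along the first point `c` of a segment can
be collapsed as well: shrink it to `c` and then collapse the remainder. -/
lemma Collapsible.union_of_convex {K R : Set E} (hK : IsCompact K) (hKc : Convex ℝ K) {c q : E}
    (hc : c ∈ K) (hR : IsClosed R) (hq : q ∈ R) (hd : Disjoint K R)
    (h : Collapsible (segment ℝ c q ∪ R)) : Collapsible (K ∪ (segment ℝ c q ∪ R)) := by
  obtain ⟨Ψ, hΨ, hΨi⟩ := h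
  obtain ⟨ε, hε, hεR⟩ : ∃ ε > 0, ∀ x ∈ R, ε ≤ infDist x K := by
    obtain ⟨δ, hδ, h⟩ := hd.exists_thickenings hK hR
    refine ⟨δ, hδ, fun x hx => ?_⟩
    by_contra! hlt
    refine h.le_bot ⟨?_, self_subset_thickening hδ R hx⟩
    rwa [mem_thickening_iff_infDist_lt ⟨c, hc⟩]
  have hmem : ∀ x, radialCollapse K c ε x ∈ segment ℝ c q ∪ R ↔
      x ∈ K ∪ (segment ℝ c q ∪ R) := by
    intro x
    have hseg := radialCollapse_mem_segment_iff hK.isClosed hKc hc hε (hεR q hq) x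
    have hRR : radialCollapse K c ε x ∈ R ↔ x ∈ R := by
      constructor
      · intro hx
        have := (hεR _ hx).trans (infDist_radialCollapse_le hKc hc hε x)
        rwa [radialCollapse_of_le hε this] at hx
      · intro hx
        rwa [radialCollapse_of_le hε (hεR x hx)]
    rw [mem_union, hseg, hRR, mem_union, mem_union, mem_union, or_assoc]
  refine ⟨Ψ ∘ radialCollapse K c ε, hΨ.comp (continuous_radialCollapse K c ε), fun x y => ?_⟩
  simp only [Function.comp, hΨi, hmem, radialCollapse_eq_iff hK.isClosed hKc hc hε]
  simp only [mem_union]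
  tauto

lemma collapsible_of_convex {K : Set E} (hK : IsClosed K) (hKc : Convex ℝ K) {c : E}
    (hc : c ∈ K) : Collapsible K :=
  ⟨radialCollapse K c 1, continuous_radialCollapse K c 1,
    radialCollapse_eq_iff hK hKc hc one_pos⟩

/-- `PolyArc B P a`: the set `P` is the union of the convex target `B` and of a simple polygonal
arc from `a` to a point of `B` that meets `B` in that point only. -/
inductive PolyArc (B : Set E) : Set E → E → Prop
  | base {a : E} (ha : a ∈ B) : PolyArc B B a
  | cons {a c : E} {P : Set E} (hP : PolyArc B P c) (ha : a ∉ P)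
      (h : segment ℝ a c ∩ P ⊆ {c}) : PolyArc B (segment ℝ a c ∪ P) a

lemma PolyArc.start_mem {B P : Set E} {a : E} (h : PolyArc B P a) : a ∈ P := by
  cases h with
  | base ha => exact ha
  | cons hP ha h => exact Or.inl (left_mem_segment ℝ _ _)

lemma isCompact_segment (a b : E) : IsCompact (segment ℝ a b) := by
  rw [segment_eq_image]
  exact isCompact_Icc.image (by fun_prop)

lemma PolyArc.isClosed {B P : Set E} {a : E} (hB : IsClosed B) (h : PolyArc B P a) :
    IsClosed P := by
  induction h with
  | base ha => exact hB
  | cons hP ha h ih => exact (isCompact_segment _ _).isClosed.union ih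

lemma PolyArc.target_subset {B P : Set E} {a : E} (h : PolyArc B P a) : B ⊆ P := by
  induction h with
  | base ha => exact subset_rfl
  | cons hP ha h ih => exact ih.trans subset_union_right

lemma PolyArc.disjoint_of_inter_subset {K P : Set E} {c d : E} (h : K ∩ (segment ℝ c d ∪ P) ⊆ {c})
    (hc : c ∉ P) : Disjoint K P := by
  rw [Set.disjoint_left]
  intro x hx hxP
  obtain rfl : x = c := h ⟨hx, Or.inr hxP⟩
  exact hc hxP

lemma PolyArc.collapsible {B P : Set E} {a : E} (hB : IsCompact B) (hBc : Convex ℝ B)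
    (h : PolyArc B P a) : Collapsible P := by
  induction h with
  | base ha => exact collapsible_of_convex hB.isClosed hBc ha
  | @cons a c P hP ha h ih =>
    have hac : a ≠ c := fun e => ha (e ▸ hP.start_mem)
    cases hP with
    | base hc =>
      have hd : Disjoint B {a} := by simpa using ha
      have hseg : segment ℝ c a ∪ {a} = segment ℝ a c := by
        rw [segment_symm, union_eq_left, singleton_subset_iff]
        exact left_mem_segment ℝ a c
      have := Collapsible.union_of_convex hB hBc hc isClosed_singleton (mem_singleton a) hd
        (by rw [hseg]; exact collapsible_of_convex (isCompact_segment a c).isClosed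
              (convex_segment a c) (left_mem_segment ℝ a c))
      rwa [hseg, union_comm] at this
    | @cons _ d P' hP' hc h' =>
      exact Collapsible.union_of_convex (isCompact_segment a c) (convex_segment a c)
        (right_mem_segment ℝ a c) (hP'.isClosed hB.isClosed) hP'.start_mem
        (disjoint_of_inter_subset h hc) ih

lemma PolyArc.collapsible_union {A B P : Set E} {a : E} (hA : IsCompact A) (hAc : Convex ℝ A)
    (hB : IsCompact B) (hBc : Convex ℝ B) (hAB : Disjoint A B) (h : PolyArc B P a) (ha : a ∈ A)
    (hAP : A ∩ P ⊆ {a}) : Collapsible (A ∪ P) := by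
  have hcol := h.collapsible hB hBc
  cases h with
  | base haB => exact absurd haB (Set.disjoint_left.1 hAB ha)
  | @cons _ d P' hP' hc h' =>
    exact Collapsible.union_of_convex hA hAc ha (hP'.isClosed hB.isClosed) hP'.start_mem
      (disjoint_of_inter_subset hAP hc) hcol

lemma eq_of_mem_segment_of_dist_le {z w x : E} (h : x ∈ segment ℝ z w)
    (hd : dist z w ≤ dist z x) : x = w := by
  have := dist_add_dist_of_mem_segment h
  exact dist_le_zero.1 (by linarith)

/-- Any point of a polygonal arc starts a polygonal subarc. -/
lemma PolyArc.exists_suffix {B P : Set E} {a : E} (h : PolyArc B P a) {w : E} (hw : w ∈ P) :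
    ∃ Q ⊆ P, PolyArc B Q w := by
  induction h with
  | base ha => exact ⟨B, subset_rfl, .base hw⟩
  | @cons a c P hP ha h ih =>
    by_cases hwP : w ∈ P
    · obtain ⟨Q, hQ, hQw⟩ := ih hwP
      exact ⟨Q, hQ.trans subset_union_right, hQw⟩
    · have hw' : w ∈ segment ℝ a c := hw.resolve_right hwP
      have hsub : segment ℝ w c ⊆ segment ℝ a c :=
        (convex_segment a c).segment_subset hw' (right_mem_segment ℝ a c)
      exact ⟨segment ℝ w c ∪ P, union_subset_union_left P hsub,
        .cons hP hwP fun x hx => h ⟨hsub hx.1, hx.2⟩⟩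

/-- Cutting a polygonal arc at its last point in a closed set. -/
lemma PolyArc.exists_last {B P Z : Set E} {a : E} (h : PolyArc B P a) (hZ : IsClosed Z)
    (hBZ : Disjoint B Z) (hPZ : (P ∩ Z).Nonempty) :
    ∃ w ∈ Z, ∃ Q ⊆ P, PolyArc B Q w ∧ Q ∩ Z ⊆ {w} := by
  induction h with
  | base ha => exact absurd hBZ (not_disjoint_iff_nonempty_inter.2 hPZ)
  | @cons a c P hP ha h ih =>
    by_cases hP' : (P ∩ Z).Nonempty
    · obtain ⟨w, hw, Q, hQ, h1⟩ := ih hP'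
      exact ⟨w, hw, Q, hQ.trans subset_union_right, h1⟩
    · have hne : (segment ℝ a c ∩ Z).Nonempty := by
        obtain ⟨x, hx | hx, hxZ⟩ := hPZ
        · exact ⟨x, hx, hxZ⟩
        · exact absurd ⟨x, hx, hxZ⟩ hP'
      have hcomp : IsCompact (segment ℝ a c ∩ Z) := (isCompact_segment a c).inter_right hZ
      obtain ⟨w, ⟨hws, hwZ⟩, hmin⟩ := hcomp.exists_isMinOn hne
        (f := fun x => dist c x) (by fun_prop)
      have hsub : segment ℝ w c ⊆ segment ℝ a c :=
        (convex_segment a c).segment_subset hws (right_mem_segment ℝ a c)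
      refine ⟨w, hwZ, segment ℝ w c ∪ P, union_subset_union_left P hsub,
        .cons hP (fun hwP => hP' ⟨w, hwP, hwZ⟩) fun x hx => h ⟨hsub hx.1, hx.2⟩, ?_⟩
      rintro x ⟨hx | hx, hxZ⟩
      · have := hmin ⟨hsub hx, hxZ⟩
        rw [segment_symm] at hx
        exact eq_of_mem_segment_of_dist_le hx this
      · exact absurd ⟨x, hx, hxZ⟩ hP'

/-- Moving the start of a polygonal arc along a segment. -/
lemma PolyArc.exists_prepend {B P : Set E} {y : E} (hB : IsClosed B) (h : PolyArc B P y) (z : E) :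
    ∃ Q ⊆ segment ℝ z y ∪ P, PolyArc B Q z := by
  by_cases hz : z ∈ P
  · obtain ⟨Q, hQ, hQz⟩ := h.exists_suffix hz
    exact ⟨Q, hQ.trans subset_union_right, hQz⟩
  have hcomp : IsCompact (segment ℝ z y ∩ P) := (isCompact_segment z y).inter_right (h.isClosed hB)
  obtain ⟨w, ⟨hws, hwP⟩, hmin⟩ := hcomp.exists_isMinOn ⟨y, right_mem_segment ℝ z y, h.start_mem⟩
    (f := fun x => dist z x) (by fun_prop)
  obtain ⟨Q, hQ, hQw⟩ := h.exists_suffix hwP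
  have hsub : segment ℝ z w ⊆ segment ℝ z y :=
    (convex_segment z y).segment_subset (left_mem_segment ℝ z y) hws
  refine ⟨segment ℝ z w ∪ Q, union_subset_union hsub hQ, .cons hQw (fun hzQ => hz (hQ hzQ)) ?_⟩
  rintro x ⟨hx, hxQ⟩
  exact eq_of_mem_segment_of_dist_le hx (hmin ⟨hsub hx, hQ hxQ⟩)

/-- Two points of a connected part of an open set are joined by a polygonal arc; here the second
point may be fattened to a convex set `B`. -/
lemma exists_polyArc {B U S : Set E} (hB : IsClosed B) (hU : IsOpen U) (hS : IsPreconnected S)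
    (hSU : S ⊆ U) {a b : E} (ha : a ∈ S) (hb : b ∈ S) (hbB : b ∈ B) :
    ∃ P ⊆ U ∪ B, PolyArc B P a := by
  let T : E → Prop := fun x => ∃ P ⊆ U ∪ B, PolyArc B P x
  have hmove : ∀ x y, T y → segment ℝ x y ⊆ U → T x := by
    rintro x y ⟨P, hPU, hP⟩ hxy
    obtain ⟨Q, hQ, hQx⟩ := hP.exists_prepend hB x
    exact ⟨Q, hQ.trans (union_subset (hxy.trans subset_union_left) hPU), hQx⟩
  refine hS.induction₂' (fun x y => T y → T x) (fun x hx => ?_)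
    (fun x y z _ _ _ hxy hyz hz => hxy (hyz hz)) ha hb ⟨B, subset_union_right, .base hbB⟩
  obtain ⟨ρ, hρ, hball⟩ := Metric.isOpen_iff.1 hU x (hSU hx)
  filter_upwards [nhdsWithin_le_nhds (ball_mem_nhds x hρ)] with y hy
  have hxy : segment ℝ x y ⊆ U :=
    ((convex_ball x ρ).segment_subset (mem_ball_self hρ) hy).trans hball
  exact ⟨fun h => hmove x y h hxy, fun h => hmove y x h (by rwa [segment_symm])⟩

/-- Two disjoint compact convex sets joined by a connected part of an open set `U` lie in a common
collapsible set that is contained in their union with `U`. -/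
lemma exists_collapsible {A B U S : Set E} (hA : IsCompact A) (hAc : Convex ℝ A) (hB : IsCompact B)
    (hBc : Convex ℝ B) (hAB : Disjoint A B) (hU : IsOpen U) (hS : IsPreconnected S) (hSU : S ⊆ U)
    {a b : E} (ha : a ∈ S) (hb : b ∈ S) (haA : a ∈ A) (hbB : b ∈ B) :
    ∃ C, A ⊆ C ∧ B ⊆ C ∧ C ⊆ A ∪ B ∪ U ∧ Collapsible C := by
  obtain ⟨P, hPU, hP⟩ := exists_polyArc hB.isClosed hU hS hSU ha hb hbB
  obtain ⟨w, hw, Q, hQ, hQw, hQA⟩ := hP.exists_last hA.isClosed hAB.symm ⟨a, hP.start_mem, haA⟩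
  refine ⟨A ∪ Q, subset_union_left, hQw.target_subset.trans subset_union_right, ?_,
    hQw.collapsible_union hA hAc hB hBc hAB hw (by rwa [inter_comm])⟩
  refine union_subset (by grind) ((hQ.trans hPU).trans (by grind))

end Collapse

/-! ### Plane nets and the contraction of an edge -/

/-- A crossing-free drawing in the plane of a multigraph with vertex type `V` and edge type `E`.
Edge `e` is the image of the interval `[lo e, hi e]`, so that a subarc is obtained by changing
the bounds only. Distinct arcs meet in vertices only. -/
structure PlaneNet (V E : Type) where
  /-- the point that represents a vertex -/
  point : V → Plane
  /-- the vertex at which an edge starts -/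
  src : E → V
  /-- the vertex at which an edge ends -/
  tgt : E → V
  /-- the left end of the parameter interval of an edge -/
  lo : E → ℝ
  /-- the right end of the parameter interval of an edge -/
  hi : E → ℝ
  /-- the curve that represents an edge, relevant on the parameter interval only -/
  curve : E → ℝ → Plane
  point_injective : Function.Injective point
  lo_lt_hi : ∀ e, lo e < hi e
  continuousOn : ∀ e, ContinuousOn (curve e) (Icc (lo e) (hi e))
  injOn : ∀ e, InjOn (curve e) (Icc (lo e) (hi e))
  curve_lo : ∀ e, curve e (lo e) = point (src e)
  curve_hi : ∀ e, curve e (hi e) = point (tgt e)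
  eq_of_point_eq : ∀ e x, ∀ t ∈ Icc (lo e) (hi e), curve e t = point x → x = src e ∨ x = tgt e
  exists_point : ∀ e f, e ≠ f → ∀ t ∈ Icc (lo e) (hi e), ∀ s ∈ Icc (lo f) (hi f),
    curve e t = curve f s → ∃ x, point x = curve e t

/-- A graph is drawn by a finite net if its edges are among those of the net. -/
def HasPlaneNet {V : Type} (G : SimpleGraph V) : Prop :=
  ∃ (E : Type) (_ : Finite E) (N : PlaneNet V E),
    ∀ x y, G.Adj x y → ∃ e, s(N.src e, N.tgt e) = s(x, y)

lemma PlaneNet.lo_mem {V E : Type} (N : PlaneNet V E) (e : E) : N.lo e ∈ Icc (N.lo e) (N.hi e) :=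
  left_mem_Icc.2 (N.lo_lt_hi e).le

lemma PlaneNet.hi_mem {V E : Type} (N : PlaneNet V E) (e : E) : N.hi e ∈ Icc (N.lo e) (N.hi e) :=
  right_mem_Icc.2 (N.lo_lt_hi e).le

lemma PlaneNet.src_ne_tgt {V E : Type} (N : PlaneNet V E) (e : E) : N.src e ≠ N.tgt e := by
  intro h
  have := N.injOn e (N.lo_mem e) (N.hi_mem e) (by rw [N.curve_lo, N.curve_hi, h])
  exact (N.lo_lt_hi e).ne this

lemma continuous_affine_unitInterval (a b : ℝ) :
    Continuous fun t : unitInterval => a + t * (b - a) := by fun_prop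

lemma affine_unitInterval_mem {a b : ℝ} (h : a ≤ b) (t : unitInterval) :
    a + t * (b - a) ∈ Icc a b := by
  have h0 := t.2.1
  have h1 := t.2.2
  constructor <;> nlinarith

/-- A graph that is drawn by a net is planar. -/
theorem HasPlaneNet.isPlanarGraph {V : Type} {G : SimpleGraph V} (h : HasPlaneNet G) :
    IsPlanarGraph G := by
  obtain ⟨E, -, N, hN⟩ := h
  have hex : ∀ e : G.edgeSet, ∃ f, s(N.src f, N.tgt f) = e.1 := by
    rintro ⟨e, he⟩
    induction e using Sym2.ind with
    | _ x y => exact hN x y he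
  choose φ hφ using hex
  have hinj : Function.Injective φ := fun e f hef => Subtype.ext (by rw [← hφ, ← hφ, hef])
  let par : G.edgeSet → unitInterval → ℝ := fun e t =>
    N.lo (φ e) + t * (N.hi (φ e) - N.lo (φ e))
  have hpar : ∀ e t, par e t ∈ Icc (N.lo (φ e)) (N.hi (φ e)) := fun e t =>
    affine_unitInterval_mem (N.lo_lt_hi _).le t
  have hends : ∀ e x t, N.curve (φ e) (par e t) = N.point x → x ∈ e.1 := by
    intro e x t ht
    rw [← hφ e, Sym2.mem_iff]
    exact N.eq_of_point_eq _ _ _ (hpar e t) ht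
  have hcommon : ∀ e f, e ≠ f → ∀ p, p ∈ range (fun t => N.curve (φ e) (par e t)) →
      p ∈ range (fun t => N.curve (φ f) (par f t)) → ∃ x, x ∈ e.1 ∧ x ∈ f.1 ∧ N.point x = p := by
    rintro e f hef p ⟨t, rfl⟩ ⟨s, hs⟩
    simp only at hs ⊢
    obtain ⟨x, hx⟩ := N.exists_point _ _ (hinj.ne hef) _ (hpar e t) _ (hpar f s) hs.symm
    exact ⟨x, hends e x t hx.symm, hends f x s (by rw [hs, hx]), hx⟩
  refine ⟨⟨N.point, fun e t => N.curve (φ e) (par e t), N.point_injective, fun e => ?_,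
    fun e t s hts => ?_, fun e => ?_, ?_, ?_⟩, ?_⟩
  · exact (N.continuousOn (φ e)).comp_continuous (continuous_affine_unitInterval _ _) (hpar e)
  · have := N.injOn _ (hpar e t) (hpar e s) hts
    have hlt := N.lo_lt_hi (φ e)
    simp only [par, add_right_inj] at this
    exact Subtype.ext (mul_right_cancel₀ (sub_pos.2 hlt).ne' this)
  · simp only [par, Set.Icc.coe_zero, Set.Icc.coe_one, zero_mul, one_mul, add_zero,
      add_sub_cancel, N.curve_lo, N.curve_hi]
    rw [← hφ e, Sym2.map_mk]
  · rintro e x ⟨t, ht⟩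
    exact hends e x t ht
  · intro e f g hef heg hfg p he hf hg
    obtain ⟨x, hxe, hxf, hx⟩ := hcommon e f hef p he hf
    obtain ⟨t, ht⟩ := hg
    exact ⟨x, hxe, hxf, hends g x t (by rw [hx]; exact ht), hx⟩
  · rw [Set.eq_empty_iff_forall_notMem]
    rintro p ⟨e, f, hef, he, hf, hno⟩
    exact hno (hcommon e f hef p he hf)

/-- Cutting a curve at its last time in a closed set: if the curve starts in the interior of the
set and ends outside, this time is not the first one. -/
lemma exists_last_time {X : Type*} [TopologicalSpace X] {g : ℝ → X} {a b : ℝ} (hab : a < b)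
    (hg : ContinuousOn g (Icc a b)) {D : Set X} (hD : IsClosed D) (ha : D ∈ 𝓝 (g a))
    (hb : g b ∉ D) : ∃ l, a < l ∧ l < b ∧ ∀ t ∈ Icc l b, g t ∈ D ↔ t = l := by
  have hcl : IsClosed (Icc a b ∩ g ⁻¹' D) := hg.preimage_isClosed_of_isClosed isClosed_Icc hD
  have hc : IsCompact (Icc a b ∩ g ⁻¹' D) :=
    isCompact_Icc.of_isClosed_subset hcl inter_subset_left
  obtain ⟨t₁, ht₁, ht₁D⟩ : ∃ t₁ ∈ Ioo a b, g t₁ ∈ D := by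
    have h1 : ContinuousWithinAt g (Ioo a b) a :=
      (hg a (left_mem_Icc.2 hab.le)).mono Ioo_subset_Icc_self
    have h2 : ∀ᶠ t in 𝓝[Ioo a b] a, g t ∈ D := h1 ha
    have h3 : (𝓝[Ioo a b] a).NeBot := by
      rw [nhdsWithin_Ioo_eq_nhdsGT hab]
      infer_instance
    obtain ⟨t, ht, ht'⟩ := (h2.and self_mem_nhdsWithin).exists
    exact ⟨t, ht', ht⟩
  obtain ⟨l, ⟨⟨hal, hlb⟩, hlD⟩, hmax⟩ := hc.exists_isMaxOn ⟨t₁, Ioo_subset_Icc_self ht₁, ht₁D⟩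
    (continuousOn_id)
  have hl1 : t₁ ≤ l := hmax ⟨Ioo_subset_Icc_self ht₁, ht₁D⟩
  refine ⟨l, ht₁.1.trans_le hl1, hlb.lt_of_ne ?_, fun t ht => ⟨fun h => ?_, ?_⟩⟩
  · rintro rfl
    exact hb hlD
  · exact le_antisymm (hmax ⟨⟨hal.trans ht.1, ht.2⟩, h⟩) ht.1
  · rintro rfl
    exact hlD

lemma exists_first_time {X : Type*} [TopologicalSpace X] {g : ℝ → X} {a b : ℝ} (hab : a < b)
    (hg : ContinuousOn g (Icc a b)) {D : Set X} (hD : IsClosed D) (hb : D ∈ 𝓝 (g b))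
    (ha : g a ∉ D) : ∃ h, a < h ∧ h < b ∧ ∀ t ∈ Icc a h, g t ∈ D ↔ t = h := by
  have hg' : ContinuousOn (fun t => g (-t)) (Icc (-b) (-a)) := by
    refine hg.comp continuousOn_neg fun t ht => ?_
    exact ⟨by linarith [ht.2], by linarith [ht.1]⟩
  obtain ⟨l, h1, h2, h3⟩ := exists_last_time (neg_lt_neg hab) hg' hD (by simpa using hb)
    (by simpa using ha)
  refine ⟨-l, by linarith, by linarith, fun t ht => ?_⟩
  have := h3 (-t) ⟨by linarith [ht.2], by linarith [ht.1]⟩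
  rw [neg_neg] at this
  rw [this, neg_eq_iff_eq_neg]

/-- The parameter interval of an edge of a net, truncated to leave a closed neighbourhood `D` of
some of the vertices. -/
lemma PlaneNet.exists_truncation {V E : Type} (N : PlaneNet V E) {D : Set Plane} (hD : IsClosed D)
    {S : Set V} (hSD : ∀ x ∈ S, D ∈ 𝓝 (N.point x)) (hSD' : ∀ x ∉ S, N.point x ∉ D) (f : E)
    (hf : N.src f ∉ S → N.tgt f ∉ S → ∀ t ∈ Icc (N.lo f) (N.hi f), N.curve f t ∉ D)
    (hS : ¬ (N.src f ∈ S ∧ N.tgt f ∈ S)) :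
    ∃ l h, N.lo f ≤ l ∧ l < h ∧ h ≤ N.hi f ∧ (N.src f ∈ S → N.lo f < l) ∧
      (N.src f ∉ S → l = N.lo f) ∧ (N.tgt f ∈ S → h < N.hi f) ∧ (N.tgt f ∉ S → h = N.hi f) ∧
      ∀ t ∈ Icc l h, N.curve f t ∈ D ↔ (t = l ∧ N.src f ∈ S) ∨ (t = h ∧ N.tgt f ∈ S) := by
  have hlt := N.lo_lt_hi f
  by_cases hs : N.src f ∈ S
  · have ht : N.tgt f ∉ S := fun ht => hS ⟨hs, ht⟩
    obtain ⟨l, h1, h2, h3⟩ := exists_last_time hlt (N.continuousOn f) hD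
      (by rw [N.curve_lo]; exact hSD _ hs) (by rw [N.curve_hi]; exact hSD' _ ht)
    exact ⟨l, N.hi f, h1.le, h2, le_rfl, fun _ => h1, fun h => absurd hs h,
      fun h => absurd h ht, fun _ => rfl, fun t h => by simp [h3 t h, hs, ht]⟩
  by_cases ht : N.tgt f ∈ S
  · obtain ⟨h, h1, h2, h3⟩ := exists_first_time hlt (N.continuousOn f) hD
      (by rw [N.curve_hi]; exact hSD _ ht) (by rw [N.curve_lo]; exact hSD' _ hs)
    exact ⟨N.lo f, h, le_rfl, h1, h2.le, fun h => absurd h hs, fun _ => rfl,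
      fun _ => h2, fun h => absurd ht h, fun t h => by simp [h3 t h, hs, ht]⟩
  · exact ⟨N.lo f, N.hi f, le_rfl, hlt, le_rfl, fun h => absurd h hs, fun _ => rfl,
      fun h => absurd h ht, fun _ => rfl, fun t h => by simp [hs, ht, hf hs ht t h]⟩

lemma PlaneNet.isClosed_arcs {V E : Type} [Finite E] (N : PlaneNet V E) (l h : E → ℝ)
    (hl : ∀ e, N.lo e ≤ l e) (hh : ∀ e, h e ≤ N.hi e) (p : E → Prop) :
    IsClosed {z | ∃ e, p e ∧ ∃ t ∈ Icc (l e) (h e), N.curve e t = z} := by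
  have : {z | ∃ e, p e ∧ ∃ t ∈ Icc (l e) (h e), N.curve e t = z} =
      ⋃ e ∈ {e | p e}, N.curve e '' Icc (l e) (h e) := by
    ext z
    simp
  rw [this]
  refine (toFinite _).isClosed_biUnion fun e _ => ?_
  exact (isCompact_Icc.image_of_continuousOn
    ((N.continuousOn e).mono (Icc_subset_Icc (hl e) (hh e)))).isClosed

lemma exists_closedBall_disjoint {X : Type*} [PseudoMetricSpace X] {F : Set X} (hF : IsClosed F)
    {p : X} (hp : p ∉ F) : ∃ r > 0, ∀ x ∈ F, x ∉ closedBall p r := by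
  obtain ⟨r, hr, h⟩ := nhds_basis_closedBall.mem_iff.1 (hF.isOpen_compl.mem_nhds hp)
  exact ⟨r, hr, fun x hx hxb => h hxb hx⟩

/-- Discs around two vertices that avoid all other vertices and all arcs that do not end at the
centre of the disc. -/
lemma PlaneNet.exists_discs {V E : Type} [Finite V] [Finite E] (N : PlaneNet V E) {a b : V}
    (hab : a ≠ b) : ∃ r > 0, ∃ r' > 0,
      Disjoint (closedBall (N.point a) r) (closedBall (N.point b) r') ∧
      (∀ x, x ≠ a → x ≠ b → N.point x ∉ closedBall (N.point a) r ∪ closedBall (N.point b) r') ∧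
      ∀ f, N.src f ≠ a → N.src f ≠ b → N.tgt f ≠ a → N.tgt f ≠ b →
        ∀ t ∈ Icc (N.lo f) (N.hi f),
          N.curve f t ∉ closedBall (N.point a) r ∪ closedBall (N.point b) r' := by
  let F : V → Set Plane := fun c =>
    {z | ∃ e, (N.src e ≠ c ∧ N.tgt e ≠ c) ∧ ∃ t ∈ Icc (N.lo e) (N.hi e), N.curve e t = z} ∪
      N.point '' {x | x ≠ c}
  have hF : ∀ c, IsClosed (F c) := fun c =>
    (N.isClosed_arcs N.lo N.hi (fun _ => le_rfl) (fun _ => le_rfl) _).union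
      (toFinite (N.point '' {x | x ≠ c})).isClosed
  have hcF : ∀ c, N.point c ∉ F c := by
    rintro c (⟨e, ⟨h1, h2⟩, t, ht, hz⟩ | ⟨x, hx, hz⟩)
    · rcases N.eq_of_point_eq e c t ht hz with h | h
      · exact h1 h.symm
      · exact h2 h.symm
    · exact hx (N.point_injective hz)
  obtain ⟨r, hr, h⟩ := exists_closedBall_disjoint (hF a) (hcF a)
  have hb : N.point b ∉ F b ∪ closedBall (N.point a) r := by
    rintro (h' | h')
    · exact hcF b h'
    · exact h _ (Or.inr ⟨b, hab.symm, rfl⟩) h'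
  obtain ⟨r', hr', h'⟩ := exists_closedBall_disjoint ((hF b).union isClosed_closedBall) hb
  refine ⟨r, hr, r', hr', ?_, ?_, ?_⟩
  · exact Set.disjoint_left.2 fun x hx hx' => h' x (Or.inr hx) hx'
  · rintro x hxa hxb (hx | hx)
    · exact h _ (Or.inr ⟨x, hxa, rfl⟩) hx
    · exact h' _ (Or.inl (Or.inr ⟨x, hxb, rfl⟩)) hx
  · rintro f h1 h2 h3 h4 t ht (hx | hx)
    · exact h _ (Or.inl ⟨f, ⟨h1, h3⟩, t, ht, rfl⟩) hx
    · exact h' _ (Or.inl (Or.inl ⟨f, ⟨h2, h4⟩, t, ht, rfl⟩)) hx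

/-- The map of the plane that contracts an edge `ab` of a net, together with the parameter
intervals to which the other edges have to be truncated. The set `S` consists of the two ends of
the edge, and `C` is the set that is collapsed. -/
lemma PlaneNet.exists_contraction {V E : Type} [Finite V] [Finite E] (N : PlaneNet V E) (e₀ : E)
    (S : Set V) (hS : S = {N.src e₀, N.tgt e₀}) :
    ∃ (l h : E → ℝ) (Φ : Plane → Plane) (C : Set Plane), Continuous Φ ∧
      (∀ x y, Φ x = Φ y ↔ x = y ∨ (x ∈ C ∧ y ∈ C)) ∧
      (∀ x, N.point x ∈ C ↔ x ∈ S) ∧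
      ∀ f, ¬ (N.src f ∈ S ∧ N.tgt f ∈ S) →
        N.lo f ≤ l f ∧ l f < h f ∧ h f ≤ N.hi f ∧
        (N.src f ∉ S → l f = N.lo f) ∧ (N.tgt f ∉ S → h f = N.hi f) ∧
        ∀ t ∈ Icc (l f) (h f),
          N.curve f t ∈ C ↔ (t = l f ∧ N.src f ∈ S) ∨ (t = h f ∧ N.tgt f ∈ S) := by
  obtain ⟨r, hr, r', hr', hAB, hpt, harc⟩ := N.exists_discs (N.src_ne_tgt e₀)
  set A := closedBall (N.point (N.src e₀)) r
  set B := closedBall (N.point (N.tgt e₀)) r'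
  have hSD : ∀ x ∈ S, A ∪ B ∈ 𝓝 (N.point x) := by
    rw [hS]
    rintro x (rfl | rfl)
    · exact mem_of_superset (closedBall_mem_nhds _ hr) subset_union_left
    · exact mem_of_superset (closedBall_mem_nhds _ hr') subset_union_right
  have hSD' : ∀ x ∉ S, N.point x ∉ A ∪ B := by
    intro x hx
    rw [hS] at hx
    simp only [mem_insert_iff, mem_singleton_iff, not_or] at hx
    exact hpt x hx.1 hx.2
  have htr : ∀ f, ∃ l h : ℝ, N.lo f ≤ l ∧ h ≤ N.hi f ∧ (¬ (N.src f ∈ S ∧ N.tgt f ∈ S) →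
      l < h ∧ (N.src f ∈ S → N.lo f < l) ∧ (N.src f ∉ S → l = N.lo f) ∧
      (N.tgt f ∈ S → h < N.hi f) ∧ (N.tgt f ∉ S → h = N.hi f) ∧
      ∀ t ∈ Icc l h, N.curve f t ∈ A ∪ B ↔
        (t = l ∧ N.src f ∈ S) ∨ (t = h ∧ N.tgt f ∈ S)) := by
    intro f
    by_cases hf : N.src f ∈ S ∧ N.tgt f ∈ S
    · exact ⟨N.lo f, N.hi f, le_rfl, le_rfl, fun h => absurd hf h⟩
    obtain ⟨l, h, h1, h2, h3, h4⟩ := N.exists_truncation (isClosed_closedBall.union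
      isClosed_closedBall) hSD hSD' f (fun h1 h2 => by
        rw [hS] at h1 h2
        simp only [mem_insert_iff, mem_singleton_iff, not_or] at h1 h2
        exact harc f h1.1 h1.2 h2.1 h2.2) hf
    exact ⟨l, h, h1, h3, fun _ => ⟨h2, h4⟩⟩
  choose l h hl hh hlh using htr
  -- The obstacles: the truncated edges and the remaining vertices.
  let F : Set Plane := {z | ∃ f, ¬ (N.src f ∈ S ∧ N.tgt f ∈ S) ∧ ∃ t ∈ Icc (l f) (h f),
    N.curve f t = z} ∪ N.point '' Sᶜ
  have hF : IsClosed F := (N.isClosed_arcs l h hl hh _).union (toFinite _).isClosed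
  have he₀F : N.curve e₀ '' Icc (N.lo e₀) (N.hi e₀) ⊆ Fᶜ := by
    rintro z ⟨t, ht, rfl⟩ (⟨f, hf, s, hs, hz⟩ | ⟨x, hx, hz⟩)
    · have hne : e₀ ≠ f := by
        rintro rfl
        exact hf (by simp [hS])
      have hs' : s ∈ Icc (N.lo f) (N.hi f) := ⟨(hl f).trans hs.1, hs.2.trans (hh f)⟩
      obtain ⟨x, hx⟩ := N.exists_point e₀ f hne t ht s hs' hz.symm
      have hxS : x ∈ S := by
        rw [hS]
        exact N.eq_of_point_eq e₀ x t ht hx.symm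
      obtain ⟨-, h1, -, h2, -, -⟩ := hlh f hf
      rcases N.eq_of_point_eq f x s hs' (by rw [hz, hx]) with rfl | rfl
      · have : s = N.lo f := N.injOn f hs' (N.lo_mem f) (by rw [hz, ← hx, N.curve_lo])
        linarith [h1 hxS, hs.1]
      · have : s = N.hi f := N.injOn f hs' (N.hi_mem f) (by rw [hz, ← hx, N.curve_hi])
        linarith [h2 hxS, hs.2]
    · have := N.eq_of_point_eq e₀ x t ht hz.symm
      exact hx (by rw [hS]; exact this)
  obtain ⟨C, hAC, hBC, hCU, Φ, hΦ, hΦC⟩ := exists_collapsible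
    (isCompact_closedBall _ _) (convex_closedBall _ _)
    (isCompact_closedBall _ _) (convex_closedBall _ _) hAB hF.isOpen_compl
    (isPreconnected_Icc.image _ (N.continuousOn e₀)) he₀F ⟨_, N.lo_mem e₀, N.curve_lo e₀⟩
    ⟨_, N.hi_mem e₀, N.curve_hi e₀⟩ (mem_closedBall_self hr.le) (mem_closedBall_self hr'.le)
  have hCF : ∀ z ∈ F, z ∈ C ↔ z ∈ A ∪ B := fun z hz =>
    ⟨fun h => (hCU h).resolve_right fun h' => h' hz, fun h => h.elim (@hAC z) (@hBC z)⟩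
  refine ⟨l, h, Φ, C, hΦ, hΦC, fun x => ?_, fun f hf => ?_⟩
  · by_cases hx : x ∈ S
    · simp only [hx, iff_true]
      exact (mem_of_mem_nhds (hSD x hx)).elim (@hAC _) (@hBC _)
    · simp only [hx, iff_false]
      rw [hCF _ (Or.inr ⟨x, hx, rfl⟩)]
      exact hSD' x hx
  · obtain ⟨h1, h2, h3, h4, h5, h6⟩ := hlh f hf
    refine ⟨hl f, h1, hh f, h3, h5, fun t ht => ?_⟩
    rw [hCF _ (Or.inl ⟨f, hf, t, ht, rfl⟩)]
    exact h6 t ht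

/-- The net obtained by contracting an edge `e₀` into its end `b`; the other end `a` disappears. -/
lemma PlaneNet.exists_contract {V E : Type} [Finite V] [Finite E] (N : PlaneNet V E) (e₀ : E)
    {a b : V} (hab : s(N.src e₀, N.tgt e₀) = s(a, b)) (ρ : V → {x // x ≠ a})
    (hρ : ∀ x, x ≠ a → (ρ x : V) = x) (hρa : (ρ a : V) = b) :
    ∃ N' : PlaneNet {x // x ≠ a} {f : E // ρ (N.src f) ≠ ρ (N.tgt f)},
      ∀ f, N'.src f = ρ (N.src f) ∧ N'.tgt f = ρ (N.tgt f) := by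
  have hba : b ≠ a := hρa ▸ (ρ a).2
  have hS : ({a, b} : Set V) = {N.src e₀, N.tgt e₀} := by
    rw [Sym2.eq_iff] at hab
    rcases hab with ⟨h1, h2⟩ | ⟨h1, h2⟩
    · rw [h1, h2]
    · rw [h1, h2, pair_comm]
  obtain ⟨l, h, Φ, C, hΦ, hΦC, hC, hlh⟩ := N.exists_contraction e₀ {a, b} hS
  have hρS : ∀ x, x ∈ ({a, b} : Set V) → (ρ x : V) = b := by
    rintro x (rfl | rfl)
    · exact hρa
    · exact hρ _ hba
  -- An edge that stays cannot have both ends in `{a, b}`: it would become a loop.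
  have hkeep : ∀ f : {f : E // ρ (N.src f) ≠ ρ (N.tgt f)},
      ¬ (N.src f ∈ ({a, b} : Set V) ∧ N.tgt f ∈ ({a, b} : Set V)) := fun f hf =>
    f.2 (Subtype.ext ((hρS _ hf.1).trans (hρS _ hf.2).symm))
  have hΦρ : ∀ x, Φ (N.point (ρ x)) = Φ (N.point x) := by
    intro x
    by_cases hx : x = a
    · subst hx
      rw [hρa, hΦC, hC, hC]
      simp
    · rw [hρ x hx]
  have hρ' : ∀ k : {x // x ≠ a}, ρ k = k := fun k => Subtype.ext (hρ k k.2)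
  have hρb : ∀ k : {x // x ≠ a}, N.point k ∈ C → (k : V) = b := by
    intro k hk
    rcases (hC _).1 hk with h | h
    · exact absurd h k.2
    · exact h
  have hIcc : ∀ f : {f : E // ρ (N.src f) ≠ ρ (N.tgt f)}, ∀ t ∈ Icc (l f) (h f),
      t ∈ Icc (N.lo f) (N.hi f) := fun f t ht =>
    ⟨(hlh f (hkeep f)).1.trans ht.1, ht.2.trans (hlh f (hkeep f)).2.2.1⟩
  have hbC : N.point b ∈ C := (hC b).2 (by simp)
  refine ⟨{
    point := fun k => Φ (N.point k)
    src := fun f => ρ (N.src f)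
    tgt := fun f => ρ (N.tgt f)
    lo := fun f => l f
    hi := fun f => h f
    curve := fun f t => Φ (N.curve f t)
    point_injective := fun j k hjk => ?_
    lo_lt_hi := fun f => (hlh f (hkeep f)).2.1
    continuousOn := fun f => hΦ.comp_continuousOn ((N.continuousOn f).mono (hIcc f))
    injOn := fun f t ht s hs hts => ?_
    curve_lo := fun f => ?_
    curve_hi := fun f => ?_
    eq_of_point_eq := fun f k t ht htk => ?_
    exists_point := fun f g hfg t ht s hs hts => ?_ }, fun f => ⟨rfl, rfl⟩⟩
  · rcases (hΦC _ _).1 hjk with h | ⟨h1, h2⟩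
    · exact Subtype.ext (N.point_injective h)
    · exact Subtype.ext ((hρb j h1).trans (hρb k h2).symm)
  · obtain ⟨-, -, -, -, -, hiff⟩ := hlh f (hkeep f)
    rcases (hΦC _ _).1 hts with h | ⟨h1, h2⟩
    · exact N.injOn f (hIcc f t ht) (hIcc f s hs) h
    · rw [hiff t ht] at h1
      rw [hiff s hs] at h2
      have := hkeep f
      grind
  · obtain ⟨-, hlt, -, h1, -, hiff⟩ := hlh f (hkeep f)
    simp only [hΦρ]
    by_cases hs : N.src f ∈ ({a, b} : Set V)
    · rw [hΦC]
      exact Or.inr ⟨(hiff _ (left_mem_Icc.2 hlt.le)).2 (Or.inl ⟨rfl, hs⟩), (hC _).2 hs⟩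
    · rw [h1 hs, N.curve_lo]
  · obtain ⟨-, hlt, -, -, h1, hiff⟩ := hlh f (hkeep f)
    simp only [hΦρ]
    by_cases hs : N.tgt f ∈ ({a, b} : Set V)
    · rw [hΦC]
      exact Or.inr ⟨(hiff _ (right_mem_Icc.2 hlt.le)).2 (Or.inr ⟨rfl, hs⟩), (hC _).2 hs⟩
    · rw [h1 hs, N.curve_hi]
  · obtain ⟨-, -, -, -, -, hiff⟩ := hlh f (hkeep f)
    rcases (hΦC _ _).1 htk with h | ⟨h1, h2⟩
    · rw [← hρ' k]
      rcases N.eq_of_point_eq f k t (hIcc f t ht) h with h | h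
      · exact Or.inl (by rw [h])
      · exact Or.inr (by rw [h])
    · have hk := hρb k h2
      rcases (hiff t ht).1 h1 with ⟨-, h3⟩ | ⟨-, h3⟩
      · exact Or.inl (Subtype.ext (by rw [hk, hρS _ h3]))
      · exact Or.inr (Subtype.ext (by rw [hk, hρS _ h3]))
  · rcases (hΦC _ _).1 hts with h | ⟨h1, h2⟩
    · obtain ⟨x, hx⟩ := N.exists_point f g (fun e => hfg (Subtype.ext e)) t (hIcc f t ht) s
        (hIcc g s hs) h
      exact ⟨ρ x, by rw [hΦρ, hx]⟩
    · exact ⟨⟨b, hba⟩, (hΦC _ _).2 (Or.inr ⟨hbC, h1⟩)⟩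

/-- Graphs that are drawn by a net are closed under the contraction of an edge. -/
lemma HasPlaneNet.contract {V : Type} [Finite V] {G : SimpleGraph V} (hG : HasPlaneNet G) {a b : V}
    (hab : G.Adj a b) (ρ : V → {x // x ≠ a}) (hρ : ∀ x, x ≠ a → (ρ x : V) = x)
    (hρa : (ρ a : V) = b) : HasPlaneNet (G.map ρ) := by
  obtain ⟨E, _, N, hN⟩ := hG
  obtain ⟨e₀, he₀⟩ := hN a b hab
  obtain ⟨N', hN'⟩ := N.exists_contract e₀ he₀ ρ hρ hρa
  refine ⟨_, inferInstance, N', ?_⟩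
  rintro x y ⟨hne, u, w, huw, rfl, rfl⟩
  obtain ⟨f, hf⟩ := hN u w huw
  have hmap : s(ρ (N.src f), ρ (N.tgt f)) = s(ρ u, ρ w) := congrArg (Sym2.map ρ) hf
  refine ⟨⟨f, fun h => hne ?_⟩, ?_⟩
  · rw [h, Sym2.eq_iff] at hmap
    rcases hmap with ⟨h1, h2⟩ | ⟨h1, h2⟩
    · exact h1.symm.trans h2
    · exact h2.symm.trans h1
  · rw [(hN' _).1, (hN' _).2, hmap]

/-- Graphs that are drawn by a net are closed under the deletion of vertices. -/
lemma HasPlaneNet.induce {V : Type} {G : SimpleGraph V} (hG : HasPlaneNet G) (s : Set V) :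
    HasPlaneNet (G.induce s) := by
  obtain ⟨E, _, N, hN⟩ := hG
  refine ⟨{e : E // N.src e ∈ s ∧ N.tgt e ∈ s}, inferInstance, {
    point := fun x => N.point x
    src := fun e => ⟨N.src e, e.2.1⟩
    tgt := fun e => ⟨N.tgt e, e.2.2⟩
    lo := fun e => N.lo e
    hi := fun e => N.hi e
    curve := fun e => N.curve e
    point_injective := N.point_injective.comp Subtype.val_injective
    lo_lt_hi := fun e => N.lo_lt_hi e
    continuousOn := fun e => N.continuousOn e
    injOn := fun e => N.injOn e
    curve_lo := fun e => N.curve_lo e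
    curve_hi := fun e => N.curve_hi e
    eq_of_point_eq := fun e x t ht h => ?_
    exists_point := fun e f hef t ht u hu h => ?_ }, ?_⟩
  · simpa only [Subtype.ext_iff] using N.eq_of_point_eq e x t ht h
  · obtain ⟨x, hx⟩ := N.exists_point e f (Subtype.coe_injective.ne hef) t ht u hu h
    refine ⟨⟨x, ?_⟩, hx⟩
    rcases N.eq_of_point_eq e x t ht hx.symm with rfl | rfl
    · exact e.2.1
    · exact e.2.2
  · rintro ⟨x, hx⟩ ⟨y, hy⟩ hxy
    obtain ⟨e, he⟩ := hN x y hxy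
    have hmem : ∀ z ∈ s(N.src e, N.tgt e), z ∈ s := by
      rw [he]
      intro z hz
      rcases Sym2.mem_iff.1 hz with rfl | rfl
      · exact hx
      · exact hy
    refine ⟨⟨e, hmem _ (Sym2.mem_mk_left _ _), hmem _ (Sym2.mem_mk_right _ _)⟩, ?_⟩
    exact Sym2.map.injective Subtype.val_injective he

/-! ### Minors and the reduction of a decomposition -/

lemma induce_connected_of_surjOn {ι κ : Type*} {G : SimpleGraph ι} {G' : SimpleGraph κ} (f : ι → κ)
    {s : Set ι} {t : Set κ} (hs : (G.induce s).Connected) (hf : MapsTo f s t) (hsurj : SurjOn f s t)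
    (hadj : ∀ x y, G.Adj x y → f x ≠ f y → G'.Adj (f x) (f y)) : (G'.induce t).Connected := by
  have key : ∀ x y : s, (G.induce s).Reachable x y →
      (G'.induce t).Reachable ⟨f x, hf x.2⟩ ⟨f y, hf y.2⟩ := by
    rintro x y ⟨p⟩
    induction p with
    | nil => rfl
    | @cons x z y h p ih =>
      by_cases hxz : f x = f z
      · have : (⟨f x, hf x.2⟩ : t) = ⟨f z, hf z.2⟩ := Subtype.ext hxz
        rwa [this]
      · have hadj' : (G'.induce t).Adj ⟨f x, hf x.2⟩ ⟨f z, hf z.2⟩ := hadj x z h hxz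
        exact hadj'.reachable.trans ih
  rw [SimpleGraph.connected_iff]
  refine ⟨?_, ?_⟩
  · rintro ⟨x, hx⟩ ⟨y, hy⟩
    obtain ⟨x, hx', rfl⟩ := hsurj hx
    obtain ⟨y, hy', rfl⟩ := hsurj hy
    exact key ⟨x, hx'⟩ ⟨y, hy'⟩ (hs.preconnected _ _)
  · obtain ⟨x⟩ := hs.nonempty
    exact ⟨⟨f x, hf x.2⟩⟩

/-- `HasNetDecomposition G c n`: the graph `G` has a decomposition of width at most `2` and order
`n` whose graph is drawn by a net, with at most `c` bags of cardinality `2`. -/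
def HasNetDecomposition {V : Type u} (G : SimpleGraph V) (c n : ℕ) : Prop :=
  ∃ (ι : Type) (_ : Fintype ι) (D : GraphDecomposition G ι), HasPlaneNet D.graph ∧
    (∀ i, (D.bag i).card ≤ 2) ∧ {i | (D.bag i).card = 2}.ncard ≤ c ∧ Fintype.card ι = n

lemma _root_.Touch.mono {ι : Type*} {D : SimpleGraph ι} {A A' B B' : Set ι} (h : Touch D A B)
    (hA : A ⊆ A') (hB : B ⊆ B') : Touch D A' B' := by
  rcases h with h | ⟨i, hi, j, hj, hij⟩
  · exact Or.inl (h.mono (inter_subset_inter hA hB))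
  · exact Or.inr ⟨i, hA hi, j, hB hj, hij⟩

lemma _root_.Touch.induce_union_connected {ι : Type*} {D : SimpleGraph ι} {A B : Set ι}
    (h : Touch D A B) (hA : (D.induce A).Connected) (hB : (D.induce B).Connected) :
    (D.induce (A ∪ B)).Connected := by
  rcases h with h | ⟨i, hi, j, hj, hij⟩
  · exact SimpleGraph.induce_union_connected hA.preconnected hB.preconnected h
  · exact SimpleGraph.connected_induce_union hA.preconnected hB.preconnected hi hj hij

lemma HasNetDecomposition.of_isContained {V : Type u} {W : Type v} {G : SimpleGraph V}
    {H : SimpleGraph W} {c n : ℕ} (hH : HasNetDecomposition H c n) (h : G.IsContained H) :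
    HasNetDecomposition G c n := by
  obtain ⟨f⟩ := h
  obtain ⟨ι, _, D, hD, h2, hc, hn⟩ := hH
  have hle : ∀ i, ((D.bag i).preimage f f.injective.injOn).card ≤ (D.bag i).card := fun i =>
    Finset.card_le_card_of_injOn f (fun x hx => by simpa using hx) f.injective.injOn
  have hset : ∀ x, {i | x ∈ (D.bag i).preimage f f.injective.injOn} = {i | f x ∈ D.bag i} :=
    fun x => by
      ext i
      exact Finset.mem_preimage
  refine ⟨ι, inferInstance, ⟨D.graph, fun i => (D.bag i).preimage f f.injective.injOn,
    fun x => ?_, fun x y hxy => ?_⟩, hD, fun i => (hle i).trans (h2 i),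
    (Set.ncard_le_ncard (fun i hi => ?_) (toFinite _)).trans hc, hn⟩
  · rw [hset]
    exact D.connected (f x)
  · rw [hset, hset]
    exact D.touch (f x) (f y) (f.toHom.map_adj hxy)
  · exact le_antisymm (h2 i) (le_of_eq_of_le (Eq.symm hi) (hle i))

open Classical in
lemma HasNetDecomposition.of_isEdgeContraction {U : Type u} {V : Type v} {K : SimpleGraph U}
    {G : SimpleGraph V} {c n : ℕ} (hK : HasNetDecomposition K c n) (h : IsEdgeContraction K G) :
    HasNetDecomposition G c n := by
  obtain ⟨a, b, f, hab, hf, hfib, hadj⟩ := h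
  obtain ⟨ι, _, D, hD, h2, hc, hn⟩ := hK
  have hle : ∀ i, ((D.bag i).image f).card ≤ (D.bag i).card := fun i => Finset.card_image_le
  have hsub : ∀ x, {i | x ∈ D.bag i} ⊆ {i | f x ∈ (D.bag i).image f} := fun x i hi =>
    Finset.mem_image_of_mem f hi
  refine ⟨ι, inferInstance, ⟨D.graph, fun i => (D.bag i).image f, fun s => ?_,
    fun s t hst => ?_⟩, hD, fun i => (hle i).trans (h2 i),
    (Set.ncard_le_ncard (fun i hi => ?_) (toFinite _)).trans hc, hn⟩
  · obtain ⟨x, rfl⟩ := hf s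
    by_cases hx : x = a ∨ x = b
    · have hset : {i | f x ∈ (D.bag i).image f} = {i | a ∈ D.bag i} ∪ {i | b ∈ D.bag i} := by
        ext i
        simp only [Finset.mem_image, mem_ofPred_eq, mem_union, hfib]
        grind
      rw [hset]
      exact (D.touch a b hab).induce_union_connected (D.connected a) (D.connected b)
    · have hset : {i | f x ∈ (D.bag i).image f} = {i | x ∈ D.bag i} := by
        ext i
        simp only [Finset.mem_image, mem_ofPred_eq, hfib]
        grind
      rw [hset]
      exact D.connected x
  · obtain ⟨-, x, y, rfl, rfl, hxy⟩ := (hadj s t).1 hst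
    exact (D.touch x y hxy).mono (hsub x) (hsub y)
  · exact le_antisymm (h2 i) (le_of_eq_of_le (Eq.symm hi) (hle i))

lemma HasNetDecomposition.of_isMinor {V : Type u} {W : Type v} {G : SimpleGraph V}
    {H : SimpleGraph W} {c n : ℕ} (hH : HasNetDecomposition H c n) (h : IsMinor H G) :
    HasNetDecomposition G c n := by
  induction h with
  | of_isContained h => exact hH.of_isContained h
  | contract _ h ih => exact ih.of_isEdgeContraction h

lemma ncard_le_of_injective {ι κ : Type*} [Finite κ] (g : ι → κ) (hg : Function.Injective g)
    (s : Set ι) (t : Set κ) (h : MapsTo g s t) : s.ncard ≤ t.ncard :=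
  ncard_le_ncard_of_injOn g h hg.injOn (toFinite t)

/-- Deleting an empty bag. -/
lemma exists_delete_bag {V : Type u} {G : SimpleGraph V} {ι : Type} [Fintype ι]
    (D : GraphDecomposition G ι) (hD : HasPlaneNet D.graph) (h2 : ∀ i, (D.bag i).card ≤ 2) {c : ℕ}
    (hc : {i | (D.bag i).card = 2}.ncard ≤ c) {i₀ : ι} (h0 : D.bag i₀ = ∅) :
    ∃ n < Fintype.card ι, HasNetDecomposition G c n := by
  classical
  have hne : ∀ x, ∀ i, x ∈ D.bag i → i ∈ ({i₀}ᶜ : Set ι) := by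
    rintro x i hx rfl
    simp [h0] at hx
  let s : Set ι := {i₀}ᶜ
  refine ⟨Fintype.card s, Fintype.card_subtype_lt (x := i₀) (by simp [s]), s, inferInstance,
    ⟨D.graph.induce s, fun i => D.bag i, fun x => ?_, fun x y hxy => ?_⟩, hD.induce s,
    fun i => h2 i, ?_, rfl⟩
  · let e : D.graph.induce {i | x ∈ D.bag i} ≃g
        (D.graph.induce s).induce {i : s | x ∈ D.bag i} :=
      { toFun := fun i => ⟨⟨i, hne x i i.2⟩, i.2⟩
        invFun := fun i => ⟨i, i.2⟩
        left_inv := fun i => rfl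
        right_inv := fun i => rfl
        map_rel_iff' := Iff.rfl }
    exact e.connected_iff.1 (D.connected x)
  · rcases D.touch x y hxy with ⟨i, hi, hi'⟩ | ⟨i, hi, j, hj, hij⟩
    · exact Or.inl ⟨⟨i, hne x i hi⟩, hi, hi'⟩
    · exact Or.inr ⟨⟨i, hne x i hi⟩, hi, ⟨j, hne y j hj⟩, hj, hij⟩
  · exact (ncard_le_of_injective Subtype.val Subtype.val_injective _ _ fun i hi => hi).trans hc

/-- Contracting a bag into an adjacent bag that contains it. -/
lemma exists_contract_bag {V : Type u} {G : SimpleGraph V} {ι : Type} [Fintype ι]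
    (D : GraphDecomposition G ι) (hD : HasPlaneNet D.graph) (h2 : ∀ i, (D.bag i).card ≤ 2) {c : ℕ}
    (hc : {i | (D.bag i).card = 2}.ncard ≤ c) {a b : ι} (hab : D.graph.Adj a b)
    (hsub : D.bag a ⊆ D.bag b) : ∃ n < Fintype.card ι, HasNetDecomposition G c n := by
  classical
  let ρ : ι → {i // i ≠ a} := fun i => if h : i ≠ a then ⟨i, h⟩ else ⟨b, hab.ne'⟩
  have hρ : ∀ i, i ≠ a → (ρ i : ι) = i := fun i hi => by simp [ρ, hi]
  have hρa : (ρ a : ι) = b := by simp [ρ]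
  have hmaps : ∀ x, MapsTo ρ {i | x ∈ D.bag i} {i | x ∈ D.bag i} := by
    intro x i hi
    by_cases hia : i = a
    · subst hia
      simp only [mem_ofPred_eq, hρa]
      exact hsub hi
    · simpa only [mem_ofPred_eq, hρ i hia] using hi
  have hadj : ∀ i j, D.graph.Adj i j → ρ i ≠ ρ j → (D.graph.map ρ).Adj (ρ i) (ρ j) :=
    fun i j hij hne => ⟨hne, i, j, hij, rfl, rfl⟩
  refine ⟨Fintype.card {i // i ≠ a}, Fintype.card_subtype_lt (x := a) (by simp), _, inferInstance,
    ⟨D.graph.map ρ, fun i => D.bag i, fun x => ?_, fun x y hxy => ?_⟩,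
    hD.contract hab ρ hρ hρa, fun i => h2 i, ?_, rfl⟩
  · exact induce_connected_of_surjOn ρ (D.connected x) (hmaps x)
      (fun i hi => ⟨i, hi, Subtype.ext (hρ i i.2)⟩) hadj
  · rcases D.touch x y hxy with ⟨i, hi, hi'⟩ | ⟨i, hi, j, hj, hij⟩
    · exact Or.inl ⟨ρ i, hmaps x hi, hmaps y hi'⟩
    · by_cases hne : ρ i = ρ j
      · exact Or.inl ⟨ρ i, hmaps x hi, hne ▸ hmaps y hj⟩
      · exact Or.inr ⟨ρ i, hmaps x hi, ρ j, hmaps y hj, hadj i j hij hne⟩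
  · exact (ncard_le_of_injective Subtype.val Subtype.val_injective _ _ fun i hi => hi).trans hc

lemma exists_adj_of_induce_connected {ι : Type*} {D : SimpleGraph ι} {s : Set ι}
    (hs : (D.induce s).Connected) {i j : ι} (hi : i ∈ s) (hj : j ∈ s) (hij : j ≠ i) :
    ∃ k ∈ s, D.Adj i k := by
  obtain ⟨p⟩ := hs.preconnected ⟨i, hi⟩ ⟨j, hj⟩
  cases p with
  | nil => exact absurd rfl hij
  | @cons _ k _ h p => exact ⟨k, k.2, h⟩

/-- In a decomposition of minimum order, no bag is empty and every singleton bag `{x}` is the only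
bag that contains `x`, so that there are at most `|V|` bags other than those of cardinality `2`. -/
lemma HasNetDecomposition.exists_le {V : Type u} [Fintype V] {G : SimpleGraph V} {c : ℕ}
    (h : ∃ n, HasNetDecomposition G c n) :
    ∃ n ≤ Fintype.card V + c, HasNetDecomposition G c n := by
  classical
  have hmin := fun m (hm : m < Nat.find h) => Nat.find_min h hm
  refine ⟨Nat.find h, ?_, Nat.find_spec h⟩
  obtain ⟨ι, _, D, hD, h2, hc, hn⟩ := Nat.find_spec h
  rw [← hn] at hmin ⊢
  have hpos : ∀ i, D.bag i ≠ ∅ := fun i hi => by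
    obtain ⟨n, hlt, hG⟩ := exists_delete_bag D hD h2 hc hi
    exact hmin n hlt hG
  have hone : ∀ i, (D.bag i).card ≠ 2 → ∃ x, D.bag i = {x} := fun i hi => by
    have h0 := Finset.card_ne_zero.2 (Finset.nonempty_iff_ne_empty.2 (hpos i))
    have := h2 i
    exact Finset.card_eq_one.1 (by omega)
  have huniq : ∀ i x, D.bag i = {x} → ∀ j, x ∈ D.bag j → j = i := by
    intro i x hi j hj
    by_contra hne
    obtain ⟨k, hk, hik⟩ := exists_adj_of_induce_connected (D.connected x)
      (show x ∈ D.bag i by simp [hi]) hj hne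
    obtain ⟨n, hlt, hG⟩ := exists_contract_bag D hD h2 hc hik (by simpa [hi] using hk)
    exact hmin n hlt hG
  have hcard : {i | (D.bag i).card = 2}ᶜ.ncard ≤ Fintype.card V := by
    have hone' : ∀ i : ι, ∃ x, (D.bag i).card ≠ 2 → D.bag i = {x} := fun i => by
      by_cases hi : (D.bag i).card = 2
      · obtain ⟨x, -⟩ := Finset.nonempty_iff_ne_empty.2 (hpos i)
        exact ⟨x, fun h => absurd hi h⟩
      · obtain ⟨x, hx⟩ := hone i hi
        exact ⟨x, fun _ => hx⟩
    choose g hg using hone'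
    rw [← Nat.card_eq_fintype_card, ← ncard_univ]
    refine ncard_le_ncard_of_injOn g (fun _ _ => mem_univ _) (fun i hi j hj hij => ?_)
      (toFinite _)
    exact (huniq j (g j) (hg j hj) i (by rw [hg i hi, hij]; simp))
  have := ncard_add_ncard_compl {i | (D.bag i).card = 2}
  rw [Nat.card_eq_fintype_card] at this
  omega

lemma HasNetDecomposition.exists_decomposition {V : Type u} {G : SimpleGraph V} {c n : ℕ}
    (h : HasNetDecomposition G c n) : ∃ (ι : Type) (_ : Fintype ι) (D : GraphDecomposition G ι),
      D.IsPlanar ∧ D.width ≤ 2 ∧ D.order = n := by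
  obtain ⟨ι, _, D, hD, h2, -, hn⟩ := h
  exact ⟨ι, inferInstance, D, hD.isPlanarGraph, Finset.sup_le fun i _ => h2 i, hn⟩

/-! ### Grids -/

lemma nat_eq_of_cast_add_eq {a b : ℕ} {t s : ℝ} (ht : t ∈ Ioo (0 : ℝ) 1) (hs : s ∈ Icc (0 : ℝ) 1)
    (h : (a : ℝ) + t = b + s) : a = b := by
  have h1 : (a : ℝ) < b + 1 := by linarith [ht.1, hs.2]
  have h2 : (b : ℝ) < a + 1 := by linarith [ht.2, hs.1]
  norm_cast at h1 h2
  omega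

lemma nat_cast_add_ne {a b : ℕ} {t : ℝ} (ht : t ∈ Ioo (0 : ℝ) 1) : (a : ℝ) + t ≠ b := by
  intro h
  have h1 : (a : ℝ) < b := by linarith [ht.1]
  have h2 : (b : ℝ) < a + 1 := by linarith [ht.2]
  norm_cast at h1 h2
  omega

/-- The edges of the `n × n` grid, directed towards larger coordinates. -/
def GridEdge (n : ℕ) : Type :=
  {e : (Fin n × Fin n) × (Fin n × Fin n) //
    ((e.1.1 : ℕ) + 1 = e.2.1 ∧ e.1.2 = e.2.2) ∨ (e.1.1 = e.2.1 ∧ (e.1.2 : ℕ) + 1 = e.2.2)}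

/-- The straight-line parametrization of a grid edge. -/
noncomputable def gridCurve {n : ℕ} (e : GridEdge n) (t : ℝ) : Plane :=
  !₂[(e.1.1.1 : ℝ) + t * ((e.1.2.1 : ℝ) - e.1.1.1), (e.1.1.2 : ℝ) + t * ((e.1.2.2 : ℝ) - e.1.1.2)]

lemma plane_ext_iff {a b c d : ℝ} : (!₂[a, b] : Plane) = !₂[c, d] ↔ a = c ∧ b = d := by
  constructor
  · intro h
    exact ⟨congrFun (congrArg (fun z : Plane => (z : Fin 2 → ℝ)) h) 0,
      congrFun (congrArg (fun z : Plane => (z : Fin 2 → ℝ)) h) 1⟩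
  · rintro ⟨rfl, rfl⟩
    rfl

lemma gridCurve_horizontal {n : ℕ} {e : GridEdge n}
    (h : (e.1.1.1 : ℕ) + 1 = e.1.2.1 ∧ e.1.1.2 = e.1.2.2) (t : ℝ) :
    gridCurve e t = !₂[(e.1.1.1 : ℝ) + t, (e.1.1.2 : ℝ)] := by
  rw [gridCurve, plane_ext_iff, ← h.1, ← h.2]
  push_cast
  constructor <;> ring

lemma gridCurve_vertical {n : ℕ} {e : GridEdge n}
    (h : e.1.1.1 = e.1.2.1 ∧ (e.1.1.2 : ℕ) + 1 = e.1.2.2) (t : ℝ) :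
    gridCurve e t = !₂[(e.1.1.1 : ℝ), (e.1.1.2 : ℝ) + t] := by
  rw [gridCurve, plane_ext_iff, ← h.1, ← h.2]
  push_cast
  constructor <;> ring

/-- An inner point of a grid edge is neither a grid point nor on another edge. -/
lemma gridCurve_ne_point {n : ℕ} (e : GridEdge n) {t : ℝ} (ht : t ∈ Ioo (0 : ℝ) 1) (a b : ℕ) :
    gridCurve e t ≠ !₂[(a : ℝ), (b : ℝ)] := by
  intro h
  rcases e.2 with he | he
  · rw [gridCurve_horizontal he, plane_ext_iff] at h
    exact nat_cast_add_ne ht h.1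
  · rw [gridCurve_vertical he, plane_ext_iff] at h
    exact nat_cast_add_ne ht h.2

lemma gridEdge_eq {n : ℕ} {e f : GridEdge n} {t s : ℝ} (ht : t ∈ Ioo (0 : ℝ) 1)
    (hs : s ∈ Icc (0 : ℝ) 1) (h : gridCurve e t = gridCurve f s) : e = f := by
  rcases e.2 with he | he <;> rcases f.2 with hf | hf
  · rw [gridCurve_horizontal he, gridCurve_horizontal hf, plane_ext_iff, Nat.cast_inj] at h
    have := nat_eq_of_cast_add_eq ht hs h.1
    obtain ⟨⟨⟨a, b⟩, c, d⟩, _⟩ := e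
    obtain ⟨⟨⟨a', b'⟩, c', d'⟩, _⟩ := f
    simp only [GridEdge, Subtype.mk.injEq, Prod.mk.injEq, Fin.ext_iff] at *
    omega
  · rw [gridCurve_horizontal he, gridCurve_vertical hf, plane_ext_iff] at h
    exact absurd h.1 (nat_cast_add_ne ht)
  · rw [gridCurve_vertical he, gridCurve_horizontal hf, plane_ext_iff] at h
    exact absurd h.2 (nat_cast_add_ne ht)
  · rw [gridCurve_vertical he, gridCurve_vertical hf, plane_ext_iff, Nat.cast_inj] at h
    have := nat_eq_of_cast_add_eq ht hs h.2
    obtain ⟨⟨⟨a, b⟩, c, d⟩, _⟩ := e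
    obtain ⟨⟨⟨a', b'⟩, c', d'⟩, _⟩ := f
    simp only [GridEdge, Subtype.mk.injEq, Prod.mk.injEq, Fin.ext_iff] at *
    omega

lemma gridCurve_zero {n : ℕ} (e : GridEdge n) :
    gridCurve e 0 = !₂[(e.1.1.1 : ℝ), (e.1.1.2 : ℝ)] := by
  simp [gridCurve]

lemma gridCurve_one {n : ℕ} (e : GridEdge n) :
    gridCurve e 1 = !₂[(e.1.2.1 : ℝ), (e.1.2.2 : ℝ)] := by
  simp [gridCurve]

lemma gridPoint_injective (n : ℕ) :
    Function.Injective fun p : Fin n × Fin n => (!₂[(p.1 : ℝ), (p.2 : ℝ)] : Plane) := by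
  rintro ⟨a, b⟩ ⟨c, d⟩ h
  simp only [plane_ext_iff, Nat.cast_inj] at h
  exact Prod.ext (Fin.ext h.1) (Fin.ext h.2)

lemma eq_or_eq_or_mem_Ioo {t : ℝ} (ht : t ∈ Icc (0 : ℝ) 1) : t = 0 ∨ t = 1 ∨ t ∈ Ioo (0 : ℝ) 1 := by
  rcases ht.1.eq_or_lt with h | h
  · exact Or.inl h.symm
  rcases ht.2.eq_or_lt with h' | h'
  · exact Or.inr (Or.inl h')
  · exact Or.inr (Or.inr ⟨h, h'⟩)

/-- The straight-line drawing of the `n × n` grid. -/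
noncomputable def gridNet (n : ℕ) : PlaneNet (Fin n × Fin n) (GridEdge n) where
  point p := !₂[(p.1 : ℝ), (p.2 : ℝ)]
  src e := e.1.1
  tgt e := e.1.2
  lo _ := 0
  hi _ := 1
  curve := gridCurve
  point_injective := gridPoint_injective n
  lo_lt_hi _ := one_pos
  continuousOn e := by
    unfold gridCurve
    fun_prop
  injOn e t _ s _ h := by
    rcases e.2 with he | he
    · rw [gridCurve_horizontal he, gridCurve_horizontal he, plane_ext_iff] at h
      linarith [h.1]
    · rw [gridCurve_vertical he, gridCurve_vertical he, plane_ext_iff] at h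
      linarith [h.2]
  curve_lo := gridCurve_zero
  curve_hi := gridCurve_one
  eq_of_point_eq e p t ht h := by
    rcases eq_or_eq_or_mem_Ioo ht with rfl | rfl | ht'
    · rw [gridCurve_zero] at h
      exact Or.inl (gridPoint_injective n h).symm
    · rw [gridCurve_one] at h
      exact Or.inr (gridPoint_injective n h).symm
    · exact absurd h (gridCurve_ne_point e ht' _ _)
  exists_point e f hef t ht s hs h := by
    rcases eq_or_eq_or_mem_Ioo ht with rfl | rfl | ht'
    · exact ⟨e.1.1, (gridCurve_zero e).symm⟩
    · exact ⟨e.1.2, (gridCurve_one e).symm⟩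
    · exact absurd (gridEdge_eq ht' hs h) hef

open SimpleGraph in
lemma hasPlaneNet_grid (n : ℕ) : HasPlaneNet (pathGraph n □ pathGraph n) := by
  refine ⟨GridEdge n, Subtype.finite, gridNet n, fun x y hxy => ?_⟩
  rw [boxProd_adj, pathGraph_adj, pathGraph_adj] at hxy
  rcases hxy with ⟨h | h, h'⟩ | ⟨h | h, h'⟩
  · exact ⟨⟨(x, y), Or.inl ⟨h, h'⟩⟩, rfl⟩
  · exact ⟨⟨(y, x), Or.inl ⟨h, h'.symm⟩⟩, Sym2.eq_swap⟩
  · exact ⟨⟨(x, y), Or.inr ⟨h', h⟩⟩, rfl⟩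
  · exact ⟨⟨(y, x), Or.inr ⟨h'.symm, h⟩⟩, Sym2.eq_swap⟩

open SimpleGraph in
/-- Every finite graph has some planar decomposition of width at most `2`: the grid on `V × V` with
the bags `{x, y}`, in which the vertex `x` occupies a row and a column. -/
lemma exists_hasNetDecomposition {V : Type u} [Finite V] (G : SimpleGraph V) :
    ∃ c n, HasNetDecomposition G c n := by
  classical
  obtain ⟨n, ⟨σ⟩⟩ := Finite.exists_equiv_fin V
  refine ⟨_, _, Fin n × Fin n, inferInstance, ⟨pathGraph n □ pathGraph n,
    fun p => {σ.symm p.1, σ.symm p.2}, fun x => ?_, fun x y _ => ?_⟩, hasPlaneNet_grid n,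
    fun p => Finset.card_le_two, le_rfl, rfl⟩
  · have hpath : ((pathGraph n).induce univ).Connected := by
      obtain ⟨k, rfl⟩ := Nat.exists_eq_succ_of_ne_zero (σ x).pos.ne'
      exact (induceUnivIso _).connected_iff.2 (pathGraph_connected k)
    have hset : {p : Fin n × Fin n | x ∈ ({σ.symm p.1, σ.symm p.2} : Finset V)} =
        {p | p.1 = σ x} ∪ {p | p.2 = σ x} := by
      ext p
      simp only [Finset.mem_insert, Finset.mem_singleton, mem_ofPred_eq, mem_union,
        Equiv.eq_symm_apply, eq_comm]
    rw [hset]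
    refine induce_union_connected (Connected.preconnected ?_) (Connected.preconnected ?_)
      ⟨(σ x, σ x), rfl, rfl⟩
    · refine induce_connected_of_surjOn (fun j => (σ x, j)) hpath (fun j _ => rfl)
        (fun p hp => ⟨p.2, mem_univ _, Prod.ext (Eq.symm hp) rfl⟩) fun i j hij _ => ?_
      exact boxProd_adj.2 (Or.inr ⟨hij, rfl⟩)
    · refine induce_connected_of_surjOn (fun j => (j, σ x)) hpath (fun j _ => rfl)
        (fun p hp => ⟨p.1, mem_univ _, Prod.ext rfl (Eq.symm hp)⟩) fun i j hij _ => ?_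
      exact boxProd_adj.2 (Or.inl ⟨hij, rfl⟩)
  · exact Or.inl ⟨(σ x, σ y), by simp, by simp⟩

/-! ### Planarization of a drawing -/

/-- The graph whose edges are exactly those of a net. -/
def PlaneNet.graph {V E : Type} (N : PlaneNet V E) : SimpleGraph V where
  Adj x y := ∃ e, s(N.src e, N.tgt e) = s(x, y)
  symm.symm x y := fun ⟨e, he⟩ => ⟨e, he.trans Sym2.eq_swap⟩
  loopless := ⟨fun x ⟨e, he⟩ => N.src_ne_tgt e (by
    rw [Sym2.eq_iff] at he
    grind)⟩

lemma PlaneNet.hasPlaneNet_graph {V E : Type} [Finite E] (N : PlaneNet V E) :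
    HasPlaneNet N.graph :=
  ⟨E, inferInstance, N, fun _ _ h => h⟩

section Planarization

variable {V : Type} {H : SimpleGraph V} (Γ : GraphDrawing H)

/-- The points of the planarization of a drawing: its vertices and its crossings. -/
def crossingPoint : V ⊕ Γ.crossings → Plane :=
  Sum.elim Γ.point Subtype.val

/-- The curve of an edge, extended to the real line by constants. -/
noncomputable def extCurve (e : H.edgeSet) : ℝ → Plane :=
  IccExtend zero_le_one (Γ.curve e)

/-- The parameters at which an edge passes through a vertex or a crossing. -/
def nodeTimes (e : H.edgeSet) : Set ℝ :=
  {t | t ∈ Icc (0 : ℝ) 1 ∧ extCurve Γ e t ∈ range (crossingPoint Γ)}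

lemma continuous_extCurve (e : H.edgeSet) : Continuous (extCurve Γ e) :=
  (Γ.curve_continuous e).Icc_extend'

lemma extCurve_mem_range (e : H.edgeSet) (t : ℝ) : extCurve Γ e t ∈ range (Γ.curve e) :=
  ⟨_, rfl⟩

lemma injOn_extCurve (e : H.edgeSet) : InjOn (extCurve Γ e) (Icc 0 1) := by
  intro t ht s hs h
  rw [extCurve, IccExtend_of_mem _ _ ht, IccExtend_of_mem _ _ hs] at h
  exact congrArg Subtype.val (Γ.curve_injective e h)

lemma exists_extCurve_eq {e : H.edgeSet} {p : Plane} (hp : p ∈ range (Γ.curve e)) :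
    ∃ t ∈ Icc (0 : ℝ) 1, extCurve Γ e t = p := by
  obtain ⟨t, rfl⟩ := hp
  exact ⟨t, t.2, IccExtend_val _ _ t⟩

lemma exists_ends (e : H.edgeSet) :
    ∃ a b, e.1 = s(a, b) ∧ extCurve Γ e 0 = Γ.point a ∧ extCurve Γ e 1 = Γ.point b := by
  have h := Γ.curve_ends e
  have h0 : extCurve Γ e 0 = Γ.curve e 0 := IccExtend_val _ _ (0 : unitInterval)
  have h1 : extCurve Γ e 1 = Γ.curve e 1 := IccExtend_val _ _ (1 : unitInterval)
  obtain ⟨e, he⟩ := e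
  induction e using Sym2.ind with
  | _ a b =>
    rw [Sym2.map_mk, Sym2.eq_iff] at h
    rcases h with ⟨h2, h3⟩ | ⟨h2, h3⟩
    · exact ⟨a, b, rfl, h0.trans h2, h1.trans h3⟩
    · exact ⟨b, a, Sym2.eq_swap, h0.trans h2, h1.trans h3⟩

lemma point_notMem_crossings (x : V) : Γ.point x ∉ Γ.crossings := by
  rintro ⟨e, f, -, he, hf, h⟩
  exact h ⟨x, Γ.mem_of_point_mem_curve e x he, Γ.mem_of_point_mem_curve f x hf, rfl⟩

lemma crossingPoint_injective : Function.Injective (crossingPoint Γ) := by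
  rintro (x | p) (y | q) h
  · exact congrArg Sum.inl (Γ.point_injective h)
  · exact absurd (show Γ.point x ∈ Γ.crossings from (show Γ.point x = q from h) ▸ q.2)
      (point_notMem_crossings Γ x)
  · exact absurd (show Γ.point y ∈ Γ.crossings from (show (p : Plane) = Γ.point y from h) ▸ p.2)
      (point_notMem_crossings Γ y)
  · exact congrArg Sum.inr (Subtype.ext h)

variable {Γ}

lemma zero_mem_nodeTimes (e : H.edgeSet) : 0 ∈ nodeTimes Γ e := by
  obtain ⟨a, b, -, h, -⟩ := exists_ends Γ e
  exact ⟨by simp, .inl a, h.symm⟩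

lemma one_mem_nodeTimes (e : H.edgeSet) : 1 ∈ nodeTimes Γ e := by
  obtain ⟨a, b, -, -, h⟩ := exists_ends Γ e
  exact ⟨by simp, .inl b, h.symm⟩

lemma finite_nodeTimes [Finite V] (hΓ : Γ.crossings.Finite) (e : H.edgeSet) :
    (nodeTimes Γ e).Finite := by
  have := hΓ.to_subtype
  exact Finite.of_finite_image ((finite_range (crossingPoint Γ)).subset
    (image_subset_iff.2 fun t ht => ht.2)) ((injOn_extCurve Γ e).mono fun t ht => ht.1)

/-- Two distinct edges meet in vertices and crossings only. -/
lemma mem_range_crossingPoint {e f : H.edgeSet} (hef : e ≠ f) {p : Plane}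
    (he : p ∈ range (Γ.curve e)) (hf : p ∈ range (Γ.curve f)) : p ∈ range (crossingPoint Γ) := by
  by_cases h : ∃ x, x ∈ e.1 ∧ x ∈ f.1 ∧ Γ.point x = p
  · obtain ⟨x, -, -, hx⟩ := h
    exact ⟨.inl x, hx⟩
  · exact ⟨.inr ⟨p, e, f, hef, he, hf, h⟩, rfl⟩

/-- The planarization of a drawing with finitely many crossings: a net on the vertices and the
crossings whose edges join consecutive nodes of an edge of the drawing. -/
lemma exists_planarization [Finite V] (hΓ : Γ.crossings.Finite) :
    ∃ (E : Type) (_ : Finite E) (N : PlaneNet (V ⊕ Γ.crossings) E),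
      ∀ e, ∀ t ∈ nodeTimes Γ e, t ≠ 0 → ∃ u ∈ nodeTimes Γ e, u < t ∧ ∀ x y,
        crossingPoint Γ x = extCurve Γ e u → crossingPoint Γ y = extCurve Γ e t →
          N.graph.Adj x y := by
  have hfin := finite_nodeTimes hΓ
  have hnode : ∀ e t, ∃ x, t ∈ nodeTimes Γ e → crossingPoint Γ x = extCurve Γ e t := by
    intro e t
    by_cases ht : t ∈ nodeTimes Γ e
    · obtain ⟨x, hx⟩ := ht.2
      exact ⟨x, fun _ => hx⟩
    · obtain ⟨a, -⟩ := exists_ends Γ e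
      exact ⟨.inl a, fun h => absurd h ht⟩
  choose node hnode using hnode
  have hnext : ∀ e t, ∃ s, t < 1 → s ∈ nodeTimes Γ e ∧ t < s ∧
      ∀ u ∈ nodeTimes Γ e, t < u → s ≤ u := by
    intro e t
    by_cases ht : t < 1
    · obtain ⟨s, ⟨hs, hts⟩, hmin⟩ := ((hfin e).inter_of_left (Ioi t)).exists_minimal
        ⟨1, one_mem_nodeTimes e, ht⟩
      refine ⟨s, fun _ => ⟨hs, hts, fun u hu htu => ?_⟩⟩
      exact (le_total s u).elim id (fun h => hmin ⟨hu, htu⟩ h)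
    · exact ⟨0, fun h => absurd h ht⟩
  choose next hnext using hnext
  let E := {p : H.edgeSet × ℝ // p.2 ∈ nodeTimes Γ p.1 ∧ p.2 < 1}
  have hE : Finite E := by
    have : ((⋃ e : H.edgeSet, (fun t => (e, t)) '' nodeTimes Γ e) : Set (H.edgeSet × ℝ)).Finite :=
      finite_iUnion fun e => (hfin e).image _
    have hsub : {p : H.edgeSet × ℝ | p.2 ∈ nodeTimes Γ p.1 ∧ p.2 < 1} ⊆
        ⋃ e : H.edgeSet, (fun t => (e, t)) '' nodeTimes Γ e := by
      rintro ⟨e, t⟩ ⟨ht, -⟩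
      exact mem_iUnion.2 ⟨e, t, ht, rfl⟩
    exact (this.subset hsub).to_subtype
  have hn : ∀ p : E, next p.1.1 p.1.2 ∈ nodeTimes Γ p.1.1 ∧ p.1.2 < next p.1.1 p.1.2 ∧
      ∀ u ∈ nodeTimes Γ p.1.1, p.1.2 < u → next p.1.1 p.1.2 ≤ u := fun p => hnext _ _ p.2.2
  have hIcc : ∀ p : E, Icc p.1.2 (next p.1.1 p.1.2) ⊆ Icc 0 1 := fun p =>
    Icc_subset_Icc p.2.1.1.1 (hn p).1.1.2
  let N : PlaneNet (V ⊕ Γ.crossings) E :=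
    { point := crossingPoint Γ
      src := fun p => node p.1.1 p.1.2
      tgt := fun p => node p.1.1 (next p.1.1 p.1.2)
      lo := fun p => p.1.2
      hi := fun p => next p.1.1 p.1.2
      curve := fun p => extCurve Γ p.1.1
      point_injective := crossingPoint_injective Γ
      lo_lt_hi := fun p => (hn p).2.1
      continuousOn := fun p => (continuous_extCurve Γ _).continuousOn
      injOn := fun p => (injOn_extCurve Γ _).mono (hIcc p)
      curve_lo := fun p => (hnode _ _ p.2.1).symm
      curve_hi := fun p => (hnode _ _ (hn p).1).symm
      eq_of_point_eq := by
        intro p x t ht h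
        have htn : t ∈ nodeTimes Γ p.1.1 := ⟨hIcc p ht, x, h.symm⟩
        rcases ht.1.eq_or_lt with h' | h'
        · left
          apply crossingPoint_injective Γ
          rw [hnode _ _ p.2.1, h', h]
        · right
          apply crossingPoint_injective Γ
          rw [hnode _ _ (hn p).1, ← h, le_antisymm ht.2 ((hn p).2.2 t htn h')]
      exists_point := by
        intro p q hpq t ht s hs h
        by_cases he : p.1.1 = q.1.1
        · obtain ⟨⟨e, a⟩, ha⟩ := p
          obtain ⟨⟨f, b⟩, hb⟩ := q
          obtain rfl : e = f := he
          obtain rfl : t = s := injOn_extCurve Γ e (hIcc _ ht) (hIcc _ hs) h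
          -- Two different intervals between nodes of the same edge share an end only.
          rcases lt_trichotomy a b with hab | rfl | hab
          · have := (hn ⟨(e, a), ha⟩).2.2 b hb.1 hab
            obtain rfl : t = b := le_antisymm (ht.2.trans this) hs.1
            exact hb.1.2
          · exact absurd rfl hpq
          · have := (hn ⟨(e, b), hb⟩).2.2 a ha.1 hab
            obtain rfl : t = a := le_antisymm (hs.2.trans this) ht.1
            exact ha.1.2
        · exact mem_range_crossingPoint he (extCurve_mem_range Γ _ _)
            (by rw [h]; exact extCurve_mem_range Γ _ _) }
  refine ⟨E, hE, N, fun e t ht ht0 => ?_⟩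
  have h0 : 0 < t := ht.1.1.lt_of_ne' ht0
  obtain ⟨u, ⟨hu, hut⟩, hmax⟩ := ((hfin e).inter_of_left (Iio t)).exists_maximal
    ⟨0, zero_mem_nodeTimes e, h0⟩
  have hut' : u < t := hut
  have hu1 : u < 1 := hut'.trans_le ht.1.2
  obtain ⟨h1, h2, h3⟩ := hnext e u hu1
  have hnt : next e u = t := by
    refine le_antisymm (h3 t ht hut) (not_lt.1 fun hlt => ?_)
    exact h2.not_ge (hmax ⟨h1, hlt⟩ h2.le)
  refine ⟨u, hu, hut, fun x y hx hy => ⟨⟨(e, u), hu, hu1⟩, ?_⟩⟩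
  have hx' : node e u = x := crossingPoint_injective Γ ((hnode e u hu).trans hx.symm)
  have hy' : node e (next e u) = y := crossingPoint_injective Γ (by
    rw [hnode e _ h1, hnt, hy])
  rw [← hx', ← hy']

lemma _root_.Touch.symm {ι : Type*} {D : SimpleGraph ι} {A B : Set ι} (h : Touch D A B) :
    Touch D B A := by
  rcases h with h | ⟨i, hi, j, hj, hij⟩
  · exact Or.inl (by rwa [inter_comm])
  · exact Or.inr ⟨j, hj, i, hi, hij.symm⟩

/-- At most two edges pass through a crossing. -/
lemma exists_pair_of_mem_crossings {p : Plane} (hp : p ∈ Γ.crossings) :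
    ∃ e f, ∀ g, p ∈ range (Γ.curve g) → g = e ∨ g = f := by
  obtain ⟨e, f, hef, he, hf, hno⟩ := hp
  refine ⟨e, f, fun g hg => ?_⟩
  by_contra! h
  obtain ⟨x, h1, h2, -, h3⟩ := Γ.no_three e f g hef h.1.symm h.2.symm p he hf hg
  exact hno ⟨x, h1, h2, h3⟩

open Classical in
/-- The planarization of a drawing is a decomposition: direct the edges, and let the bag of a
crossing consist of the tails of the two edges that cross there. -/
theorem hasNetDecomposition_of_drawing [Finite V] (hΓ : Γ.crossings.Finite) :
    ∃ n, HasNetDecomposition H Γ.crossings.ncard n := by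
  obtain ⟨E, _, N, hN⟩ := exists_planarization hΓ
  choose tail head hends h0 h1 using exists_ends Γ
  have := Fintype.ofFinite V
  have := hΓ.fintype
  have := Fintype.ofFinite H.edgeSet
  let bag : V ⊕ Γ.crossings → Finset V := Sum.elim (fun x => {x})
    fun p => {e | (p : Plane) ∈ range (Γ.curve e)}.toFinset.image tail
  have hbagl : ∀ x y, y ∈ bag (.inl x) ↔ y = x := fun x y => Finset.mem_singleton
  have hbagr : ∀ p y, y ∈ bag (.inr p) ↔ ∃ e, (p : Plane) ∈ range (Γ.curve e) ∧ tail e = y := by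
    intro p y
    simp [bag]
  -- The nodes of an edge before its head carry its tail.
  have hmem : ∀ e, ∀ t ∈ nodeTimes Γ e, t < 1 → ∀ x, crossingPoint Γ x = extCurve Γ e t →
      tail e ∈ bag x := by
    rintro e t ht ht1 (x | p) hx
    · rw [hbagl]
      have hxe : x ∈ e.1 := Γ.mem_of_point_mem_curve e x
        ((show Γ.point x = _ from hx) ▸ extCurve_mem_range Γ e t)
      rw [hends, Sym2.mem_iff] at hxe
      rcases hxe with h | h
      · exact h.symm
      · have : t = 1 := injOn_extCurve Γ e ht.1 (by simp) (by
          rw [h1, ← h, ← hx]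
          rfl)
        exact absurd this ht1.ne
    · rw [hbagr]
      exact ⟨e, (show (p : Plane) = _ from hx) ▸ extCurve_mem_range Γ e t, rfl⟩
  have hself : ∀ x, x ∈ bag (.inl x) := fun x => (hbagl x x).2 rfl
  have hreach : ∀ e, ∀ t ∈ nodeTimes Γ e, t < 1 → ∀ x (hx : tail e ∈ bag x),
      crossingPoint Γ x = extCurve Γ e t →
      (N.graph.induce {i | tail e ∈ bag i}).Reachable ⟨.inl (tail e), hself _⟩ ⟨x, hx⟩ := by
    intro e t ht
    apply ((finite_nodeTimes hΓ e).wellFoundedOn (r := (· < ·))).induction ht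
    intro t ht ih ht1 x hx hxt
    by_cases ht0 : t = 0
    · have : x = .inl (tail e) := crossingPoint_injective Γ (by
        rw [hxt, ht0, h0]
        rfl)
      subst this
      rfl
    · obtain ⟨u, hu, hut, hadj⟩ := hN e t ht ht0
      obtain ⟨y, hy⟩ := hu.2
      have hu1 := hut.trans ht1
      have hye := hmem e u hu hu1 y hy
      have hyx : (N.graph.induce {i | tail e ∈ bag i}).Adj ⟨y, hye⟩ ⟨x, hx⟩ := hadj y x hy hxt
      exact (ih u hu hut hu1 y hye hy).trans hyx.reachable
  have htouch : ∀ e, Touch N.graph {i | tail e ∈ bag i} {i | head e ∈ bag i} := by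
    intro e
    obtain ⟨u, hu, hu1, hadj⟩ := hN e 1 (one_mem_nodeTimes e) one_ne_zero
    obtain ⟨y, hy⟩ := hu.2
    exact Or.inr ⟨y, hmem e u hu hu1 y hy, .inl (head e), hself _,
      hadj y _ hy (h1 e).symm⟩
  refine ⟨_, V ⊕ Γ.crossings, inferInstance, ⟨N.graph, bag, fun x => ?_, fun x y hxy => ?_⟩,
    N.hasPlaneNet_graph, ?_, ?_, rfl⟩
  · rw [SimpleGraph.connected_iff_exists_forall_reachable]
    refine ⟨⟨.inl x, hself x⟩, ?_⟩
    rintro ⟨y | p, hi⟩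
    · obtain rfl : x = y := (hbagl y x).1 hi
      rfl
    · obtain ⟨e, hpe, rfl⟩ := (hbagr p x).1 hi
      obtain ⟨t, ht, htp⟩ := exists_extCurve_eq Γ hpe
      have ht1 : t ≠ 1 := by
        rintro rfl
        exact point_notMem_crossings Γ (head e) (by rw [← h1, htp]; exact p.2)
      exact hreach e t ⟨ht, .inr p, htp.symm⟩ (ht.2.lt_of_ne ht1) _ hi htp.symm
  · have he := hends ⟨s(x, y), hxy⟩
    have ht := htouch ⟨s(x, y), hxy⟩
    rw [Sym2.eq_iff] at he
    rcases he with ⟨h2, h3⟩ | ⟨h2, h3⟩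
    · rwa [← h2, ← h3] at ht
    · rw [← h2, ← h3] at ht
      exact ht.symm
  · rintro (x | p)
    · exact (Finset.card_singleton x).le.trans one_le_two
    · obtain ⟨e, f, hef⟩ := exists_pair_of_mem_crossings p.2
      have hsub : bag (.inr p) ⊆ {tail e, tail f} := by
        intro y hy
        obtain ⟨g, hg, rfl⟩ := (hbagr p y).1 hy
        rcases hef g hg with rfl | rfl <;> simp
      exact (Finset.card_le_card hsub).trans Finset.card_le_two
  · have hsub : {i | (bag i).card = 2} ⊆ range (Sum.inr : Γ.crossings → V ⊕ Γ.crossings) := by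
      rintro (x | p) hi
      · have : (1 : ℕ) = 2 := (Finset.card_singleton x).symm.trans hi
        omega
      · exact ⟨p, rfl⟩
    refine (ncard_le_ncard hsub (toFinite _)).trans ?_
    rw [← image_univ, ncard_image_of_injective _ Sum.inr_injective, ncard_univ,
      Nat.card_coe_set_eq]

end Planarization

end PlanarDecomposition

open PlanarDecomposition in
theorem mainTheorem6 {V : Type u} [Fintype V] (G : SimpleGraph V) :
    ∃ (ι : Type) (_ : Fintype ι) (D : GraphDecomposition G ι),
      D.IsPlanar ∧ D.width ≤ 2 ∧
        (D.order : ℕ∞) ≤ (Fintype.card V : ℕ∞) + 2 * minorCrossingNumber G := by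
  by_cases htop : minorCrossingNumber G = ⊤
  · obtain ⟨c, n, h⟩ := exists_hasNetDecomposition G
    obtain ⟨ι, hι, D, h1, h2, -⟩ := h.exists_decomposition
    exact ⟨ι, hι, D, h1, h2, by simp [htop]⟩
  · obtain ⟨k, hk⟩ := ENat.ne_top_iff_exists.1 htop
    have hlt : minorCrossingNumber G < k + 1 := by
      rw [← hk]
      exact_mod_cast Nat.lt_succ_self k
    simp only [minorCrossingNumber, crossingNumber, iInf_lt_iff] at hlt
    obtain ⟨m, H, hHG, Γ, hΓ⟩ := hlt
    have hfin : Γ.crossings.Finite := Set.encard_lt_top_iff.1 (hΓ.trans_le le_top)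
    rw [← hfin.cast_ncard_eq] at hΓ
    have hle : Γ.crossings.ncard ≤ k := by
      have : Γ.crossings.ncard < k + 1 := by exact_mod_cast hΓ
      omega
    obtain ⟨n₀, hn₀⟩ := hasNetDecomposition_of_drawing hfin
    obtain ⟨n, hn, h⟩ := HasNetDecomposition.exists_le ⟨n₀, hn₀.of_isMinor hHG⟩
    obtain ⟨ι, hι, D, h1, h2, h3⟩ := h.exists_decomposition
    refine ⟨ι, hι, D, h1, h2, ?_⟩
    rw [h3, ← hk]
    exact_mod_cast (by omega : n ≤ Fintype.card V + 2 * k)
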